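/- Let $m\ge 2$ be an integer and let $q\ge 4$ be a prime power. Put $T=\mathrm{PSL}(2,q)$, $H=T\wr S_m=T^m\rtimes S_m$ and $L=\{(x,\dots,x)\sigma \mid x\in T,\ \sigma\in S_m\}\le H$, and let $\phi:L\to\mathrm{Aut}(T)$ send $(x,\dots,x)\sigma$ to the inner automorphism $t\mapsto t^x=x^{-1}tx$. Let $$N=\{f:H\to T \mid f(z\ell)=f(z)^{\phi(\ell)}\ \text{for all } z\in H,\ \ell\in L\},$$ a group under pointwise multiplication, on which $H$ acts by automorphisms via $f^x(z)=f(xz)$. Let $G(m,q)=N\rtimes H$ be the twisted wreath product, acting on the set $N$, with $N$ acting by right multiplication and $H$ by automorphisms: $\alpha^{nh}=(\alpha n)^h$. For a transitive group $G$ on a finite set $\Omega$ and $\alpha\in\Omega$, a nontrivial subdegree of $G$ (relative to $\alpha$) is the size of an orbit of the point stabiliser $G_\alpha$ on $\Omega$ other than $\{\alpha\}$. Theorem. Relative to any point of $N$, the following hold. 1. If $m=2$ and $q\equiv 3\pmod 4$, then there is a divisor $d$ of $2(q+1)^2$ such that $\left(\tfrac12 q(q-1)\right)^2$ and $d$ are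 nontrivial coprime subdegrees of $G(2,q)$. 2. If $m\ge 3$ and $q\equiv 3\pmod 4$, then $\left(\tfrac12 q(q-1)\right)^m$ and $(q+1)^m$ are nontrivial coprime subdegrees of $G(m,q)$. 3. If $m\ge 3$ and $q$ is even, then $\left(\tfrac12 q(q-1)\right)^m$ and $(q+1)^m$ are nontrivial coprime subdegrees of $G(m,q)$, and so are $\left(q(q-1)\right)^m$ and $(q+1)^m$. 4. If $q=29$ (and $m\ge 2$ is arbitrary), then $30^m$ and $203^m$ are nontrivial coprime subdegrees of $G(m,29)$. 5. If $q=7$ (and $m\ge 2$ is arbitrary), then $7^m$ and $24^m$ are nontrivial coprime subdegrees of $G(m,7)$. 6. If $q=11$ (and $m\ge 2$ is arbitrary), then $11^m$ and $60^m$ are nontrivial coprime subdegrees of $G(m,11)$. -/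

import Mathlib

section Subdegrees

/-- `d` is a nontrivial subdegree of `G` acting on `Ω`, relative to the point `α`: the size of
an orbit of the point stabiliser `G_α` other than the trivial orbit `{α}`. -/
def IsNontrivialSubdegree (G : Type*) {Ω : Type*} [Group G] [MulAction G Ω]
    (α : Ω) (d : ℕ) : Prop :=
  ∃ β : Ω, MulAction.orbit (MulAction.stabilizer G α) β ≠ {α} ∧
    Nat.card (MulAction.orbit (MulAction.stabilizer G α) β) = d

/-- `r` and `d` are nontrivial coprime subdegrees of `G` relative to the point `α`. -/
def AreNontrivialCoprimeSubdegrees (G : Type*) {Ω : Type*} [Group G] [MulAction G Ω]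
    (α : Ω) (r d : ℕ) : Prop :=
  IsNontrivialSubdegree G α r ∧ IsNontrivialSubdegree G α d ∧ Nat.Coprime r d

end Subdegrees

namespace TwistedWreath

section General

variable {T H : Type*} [Group T] [Group H] (L : Subgroup H) (φ : L →* MulAut T)

/-- The group `N` of all functions `f : H → T` with `f (z ℓ) = f(z) ^ φ(ℓ)`. Exponents denote
right actions, so `t ^ φ(ℓ)` is `(φ ℓ)⁻¹ t` for the left action of `MulAut T` on `T`. -/
def base : Subgroup (H → T) where
  carrier := {f | ∀ (z : H) (l : L), f (z * l) = (φ l)⁻¹ (f z)}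
  one_mem' := by intro z l; simp
  mul_mem' := by
    intro f g hf hg z l
    simp only [Pi.mul_apply, map_mul, hf z l, hg z l]
  inv_mem' := by
    intro f hf z l
    simp only [Pi.inv_apply, map_inv, hf z l]

/-- The action of `H` on `N`: the right action `f ^ x (z) = f (x z)`, turned into the left action
`(x • f) = f ^ (x⁻¹)`. -/
def baseAut : H →* MulAut (base L φ) where
  toFun x :=
    { toFun := fun f => ⟨fun z => f.1 (x⁻¹ * z), fun z l => by
        simpa only [mul_assoc] using f.2 (x⁻¹ * z) l⟩
      invFun := fun f => ⟨fun z => f.1 (x * z), fun z l => by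
        simpa only [mul_assoc] using f.2 (x * z) l⟩
      left_inv := fun f => by ext z; simp
      right_inv := fun f => by ext z; simp
      map_mul' := fun f g => rfl }
  map_one' := by ext f z; simp
  map_mul' x y := by ext f z; simp [mul_assoc]

/-- The twisted wreath product `N ⋊ H` determined from `(T, H, φ)`. -/
abbrev Product : Type _ := base L φ ⋊[baseAut L φ] H

/-- The twisted wreath product acts on `N`, with `N` acting by right multiplication and `H` by
automorphisms. The right action `α ^ (n h) = (α n) ^ h` is turned into a left action by inverting
group elements: `(n h) • α = α ^ (h⁻¹ n⁻¹) = (h • α) n⁻¹`. -/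
instance productAction : MulAction (Product L φ) (base L φ) where
  smul g α := baseAut L φ g.right α * g.left⁻¹
  one_smul α := by
    change baseAut L φ 1 α * (1 : base L φ)⁻¹ = α
    simp
  mul_smul g h α := by
    change baseAut L φ (g.right * h.right) α * (g.left * baseAut L φ g.right h.left)⁻¹ =
      baseAut L φ g.right (baseAut L φ h.right α * h.left⁻¹) * g.left⁻¹
    simp [mul_assoc]

end General

section Diagonal

variable (m : ℕ) (T : Type*) [Group T]

/-- The wreath product `T ≀ S_m = T ^ m ⋊ S_m`, where `S_m` permutes the coordinates. -/
abbrev Wr : Type _ := (Fin m → T) ⋊[mulAutArrow] Equiv.Perm (Fin m)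

/-- The subgroup `L = {(x, …, x) σ | x ∈ T, σ ∈ S_m}` of `T ≀ S_m`. -/
def diag : Subgroup (Wr m T) where
  carrier := {h | ∃ (x : T) (σ : Equiv.Perm (Fin m)), h = ⟨fun _ => x, σ⟩}
  one_mem' := ⟨1, 1, rfl⟩
  mul_mem' := by
    rintro _ _ ⟨x, σ, rfl⟩ ⟨y, τ, rfl⟩
    exact ⟨x * y, σ * τ, rfl⟩
  inv_mem' := by
    rintro _ ⟨x, σ, rfl⟩
    exact ⟨x⁻¹, σ⁻¹, rfl⟩

/-- The homomorphism `L → Aut T` sending `(x, …, x) σ` to conjugation by `x`. -/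
def diagConj [NeZero m] : diag m T →* MulAut T where
  toFun l := MulAut.conj (l.1.left 0)
  map_one' := by
    change MulAut.conj (1 : T) = 1
    simp
  map_mul' := by
    rintro ⟨_, x, σ, rfl⟩ ⟨_, y, τ, rfl⟩
    change MulAut.conj (x * y) = MulAut.conj x * MulAut.conj y
    simp

end Diagonal

variable (m : ℕ) [NeZero m] (F : Type*) [Field F]

/-- The set `N` on which `G(m, q)` acts, where `q` is the order of the field `F`. -/
abbrev Points : Type _ :=
  base (diag m (Matrix.ProjectiveSpecialLinearGroup (Fin 2) F))
    (diagConj m (Matrix.ProjectiveSpecialLinearGroup (Fin 2) F))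

/-- The group `G(m, q)`, where `q` is the order of the field `F`: the twisted wreath product
determined from `T = PSL(2, F)`, `T ≀ S_m` and the homomorphism `L → Aut T`. -/
abbrev G : Type _ :=
  Product (diag m (Matrix.ProjectiveSpecialLinearGroup (Fin 2) F))
    (diagConj m (Matrix.ProjectiveSpecialLinearGroup (Fin 2) F))

end TwistedWreath

/-!
# Coprime subdegrees of the twisted wreath products `G(m, q)`

The stabiliser of the identity of `N` is `H = T ≀ S_m`, so that subdegrees are sizes of `H`-orbits
on `N`, the same at every point because `G(m, q)` is transitive (`isNontrivialSubdegree_of_ne_one`).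
Elements of `N` are produced from a transitive `T`-set `Ω`, in practice the cosets of a subgroup
`A` of `T`, and a map `g : Ω ^ m → T` that turns the diagonal action of `T` into conjugation: a
point `x` of `Ω ^ m` gives the function `(t₁, …, t_m) σ ↦ g (t₁⁻¹ x₁, …, t_m⁻¹ x_m)`, called
`ofPoint`. If `g` is symmetric, these functions for all `x` form a single `H`-orbit, and if they
are distinct, its size is `|Ω| ^ m = |T : A| ^ m`. For a map `g` that is not symmetric, the orbit
size still divides `m! |Ω| ^ m` (`exists_isNontrivialSubdegree_dvd`). Three kinds of maps are used.

* `Ω` is the class of an element `c ≠ 1`, and `g (x, …, x) = x`, with trivial values off the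
  diagonal. This gives `|c ^ T| ^ m` (`isNontrivialSubdegree_index_centralizer`): the class
  of involutions for `q ≡ 3 (mod 4)`, the class of an element of a nonsplit torus for even `q`,
  and a class of unipotent elements for `q = 7, 11`.
* `g` is supported on the translates of `(a, b, …, b)` and their permutations, with values
  the conjugates of an element `c ≠ 1` that commutes with the stabiliser of the pair. Distinctness
  of the functions holds if `m ≥ 3` and point stabilisers are not nested, or if `T` is primitive on
  `Ω` (`isNontrivialSubdegree_index_of_three_le`, `isNontrivialSubdegree_index_of_isCoatom`).
  The first criterion is applied to the Borel subgroup and, for even `q`, to the dihedral group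
  of order `2 (q + 1)`; the second one to the Borel subgroup for `q = 29` and to the
  subgroups `S₄`, `A₅`, `A₅` of index `7`, `11`, `203` for `q = 7, 11, 29`.
* For `m = 2` and `q ≡ 3 (mod 4)` the element `c` of the split torus does not commute with the
  matrices that interchange the two fixed points `a`, `b` of the torus on the projective line.
  There `g` is supported on the translates of the ordered pair `(a, b)`, and only the
  divisibility of the orbit size is available.

The group theory of `PSL(2, q)` is done with preimages in `SL(2, q)`. The exceptional subgroups are
given by explicit matrices over the prime field, whose properties are verified by computation.
The maximality of `A₅` in `PSL(2, 29)` follows from the fact that any larger group contains an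
element of order `29`, so that its index divides `7`, while the simple group `PSL(2, 29)` cannot act
nontrivially on `7` points (`isCoatom_of_index_eq`).
-/

open scoped MatrixGroups

namespace TwistedWreath

/-! ### Subdegrees and orbits of `H` on `N` -/

section Points

/-- The property of being a nontrivial subdegree is the same at all points of an orbit. -/
theorem _root_.IsNontrivialSubdegree.smul {G Ω : Type*} [Group G] [MulAction G Ω] {α : Ω} {d : ℕ}
    (h : IsNontrivialSubdegree G α d) (g : G) : IsNontrivialSubdegree G (g • α) d := by
  obtain ⟨β, hne, hcard⟩ := h
  have key : MulAction.orbit (MulAction.stabilizer G (g • α)) (g • β) =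
      (fun ω => g • ω) '' MulAction.orbit (MulAction.stabilizer G α) β := by
    ext ω
    constructor
    · rintro ⟨⟨k, hk⟩, rfl⟩
      refine ⟨(g⁻¹ * k * g) • β, ⟨⟨g⁻¹ * k * g, ?_⟩, rfl⟩, ?_⟩
      · rw [MulAction.mem_stabilizer_iff] at hk ⊢
        rw [mul_smul, mul_smul, hk, inv_smul_smul]
      · change g • (g⁻¹ * k * g) • β = k • g • β
        simp [mul_smul]
    · rintro ⟨_, ⟨⟨k, hk⟩, rfl⟩, rfl⟩
      refine ⟨⟨g * k * g⁻¹, ?_⟩, ?_⟩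
      · rw [MulAction.mem_stabilizer_iff] at hk ⊢
        simp [mul_smul, hk]
      · change (g * k * g⁻¹) • g • β = g • k • β
        simp [mul_smul]
  refine ⟨g • β, fun h => hne ?_, ?_⟩
  · rw [key] at h
    have := congrArg (fun s => (fun ω => g • ω) ⁻¹' s) h
    rw [Set.preimage_image_eq _ (MulAction.injective g)] at this
    rw [this]
    ext ω
    simp
  · rw [key, Nat.card_image_of_injective (MulAction.injective g), hcard]

variable {T H : Type*} [Group T] [Group H] {L : Subgroup H} {φ : L →* MulAut T}

theorem productAction_def (g : Product L φ) (α : base L φ) :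
    g • α = baseAut L φ g.right α * g.left⁻¹ := rfl

/-- The stabiliser of the identity of `N` is `H`, so its orbits are the `H`-orbits on `N`. -/
theorem orbit_stabilizer_one (f : base L φ) :
    MulAction.orbit (MulAction.stabilizer (Product L φ) (1 : base L φ)) f =
      Set.range fun h : H => baseAut L φ h f := by
  ext k
  constructor
  · rintro ⟨⟨g, hg⟩, rfl⟩
    rw [MulAction.mem_stabilizer_iff, productAction_def, map_one, one_mul, inv_eq_one] at hg
    refine ⟨g.right, ?_⟩
    change _ = g • f
    rw [productAction_def, hg]
    simp
  · rintro ⟨h, rfl⟩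
    refine ⟨⟨SemidirectProduct.inr h, ?_⟩, ?_⟩
    · rw [MulAction.mem_stabilizer_iff, productAction_def]
      simp
    · change (SemidirectProduct.inr h : Product L φ) • f = _
      rw [productAction_def]
      simp

/-- The size of the `H`-orbit of a nontrivial `f ∈ N` is a nontrivial subdegree at every point. -/
theorem isNontrivialSubdegree_of_ne_one {f : base L φ} (hf : f ≠ 1) {d : ℕ}
    (hd : Nat.card (Set.range fun h : H => baseAut L φ h f) = d) (α : base L φ) :
    IsNontrivialSubdegree (Product L φ) α d := by
  have h1 : IsNontrivialSubdegree (Product L φ) (1 : base L φ) d := by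
    refine ⟨f, fun h => hf ?_, by rw [orbit_stabilizer_one, hd]⟩
    have : f ∈ MulAction.orbit (MulAction.stabilizer (Product L φ) (1 : base L φ)) f :=
      MulAction.mem_orbit_self f
    rw [h] at this
    exact this
  have h2 := h1.smul (SemidirectProduct.inl α⁻¹)
  have h3 : (SemidirectProduct.inl α⁻¹ : Product L φ) • (1 : base L φ) = α := by
    rw [productAction_def]
    simp
  rwa [h3] at h2

end Points

/-! ### Elements of `N` from equivariant maps -/

section Equivariant

variable {m : ℕ} [NeZero m] {T Ω : Type*} [Group T] [MulAction T Ω]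

/-- A map `g : Ω ^ m → T` that intertwines the diagonal action of `T` with conjugation. -/
def IsConjEquivariant (g : (Fin m → Ω) → T) : Prop :=
  ∀ (t : T) (x : Fin m → Ω), g (t • x) = t * g x * t⁻¹

/-- The map is invariant under permutations of the coordinates. -/
def IsSymm (g : (Fin m → Ω) → T) : Prop :=
  ∀ (σ : Equiv.Perm (Fin m)) (x : Fin m → Ω), g (x ∘ σ) = g x

/-- The element `(t₁, …, t_m) σ ↦ g (t₁⁻¹ x₁, …, t_m⁻¹ x_m)` of `N` that an equivariant map `g`
and a point `x` of `Ω ^ m` define. -/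
def ofPoint {g : (Fin m → Ω) → T} (hg : IsConjEquivariant g) (x : Fin m → Ω) :
    base (diag m T) (diagConj m T) :=
  ⟨fun h => g (h.left⁻¹ • x), by
    rintro h ⟨_, y, σ, rfl⟩
    have h1 : (h * ⟨fun _ => y, σ⟩ : Wr m T).left⁻¹ • x = y⁻¹ • h.left⁻¹ • x := by
      ext i
      change (h.left i * y)⁻¹ • x i = y⁻¹ • (h.left i)⁻¹ • x i
      rw [mul_inv_rev, mul_smul]
    change g ((h * ⟨fun _ => y, σ⟩ : Wr m T).left⁻¹ • x) =
      (MulAut.conj y)⁻¹ (g (h.left⁻¹ • x))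
    rw [h1, hg, inv_inv, MulAut.conj_inv_apply]⟩

theorem ofPoint_apply {g : (Fin m → Ω) → T} (hg : IsConjEquivariant g) (x : Fin m → Ω)
    (h : Wr m T) : (ofPoint hg x).1 h = g (h.left⁻¹ • x) := rfl

theorem ofPoint_eq_iff {g : (Fin m → Ω) → T} (hg : IsConjEquivariant g) {x y : Fin m → Ω} :
    ofPoint hg x = ofPoint hg y ↔ ∀ t : Fin m → T, g (t • x) = g (t • y) := by
  constructor
  · intro h t
    have := congrFun (congrArg Subtype.val h) ⟨t⁻¹, 1⟩
    simpa [ofPoint_apply] using this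
  · intro h
    apply Subtype.ext
    funext k
    exact h _

theorem ofPoint_ne_one {g : (Fin m → Ω) → T} (hg : IsConjEquivariant g) {x : Fin m → Ω}
    (hx : g x ≠ 1) : ofPoint hg x ≠ 1 := by
  intro h
  have := congrFun (congrArg Subtype.val h) 1
  rw [ofPoint_apply] at this
  apply hx
  simpa using this

theorem baseAut_ofPoint {g : (Fin m → Ω) → T} (hg : IsConjEquivariant g) (hs : IsSymm g)
    (h : Wr m T) (x : Fin m → Ω) :
    baseAut (diag m T) (diagConj m T) h (ofPoint hg x) =
      ofPoint hg (h.left • (x ∘ ⇑(h.right⁻¹))) := by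
  apply Subtype.ext
  funext z
  change g ((h⁻¹ * z).left⁻¹ • x) = g (z.left⁻¹ • h.left • (x ∘ ⇑(h.right⁻¹)))
  rw [← hs h.right (z.left⁻¹ • h.left • (x ∘ ⇑(h.right⁻¹)))]
  congr 1
  funext i
  change ((h.left (h.right⁻¹⁻¹ i))⁻¹ * z.left (h.right⁻¹⁻¹ i))⁻¹ • x i =
    (z.left (h.right i))⁻¹ • h.left (h.right i) • x (h.right⁻¹ (h.right i))
  simp [mul_smul]

/-- For a symmetric equivariant `g` on a transitive `T`-set `Ω`, the `ofPoint hg y` form one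
`H`-orbit; if they are distinct, its size is `|Ω| ^ m`. -/
theorem isNontrivialSubdegree_of_injective [MulAction.IsPretransitive T Ω]
    {g : (Fin m → Ω) → T} (hg : IsConjEquivariant g) (hs : IsSymm g)
    (hinj : Function.Injective (ofPoint hg)) {x : Fin m → Ω} (hx : g x ≠ 1)
    (α : base (diag m T) (diagConj m T)) :
    IsNontrivialSubdegree (Product (diag m T) (diagConj m T)) α (Nat.card Ω ^ m) := by
  refine isNontrivialSubdegree_of_ne_one (ofPoint_ne_one hg hx) ?_ α
  have h1 : (Set.range fun h : Wr m T => baseAut (diag m T) (diagConj m T) h (ofPoint hg x)) =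
      Set.range (ofPoint hg) := by
    ext f
    constructor
    · rintro ⟨h, rfl⟩
      exact ⟨_, (baseAut_ofPoint hg hs h x).symm⟩
    · rintro ⟨y, rfl⟩
      choose t ht using fun i => MulAction.exists_smul_eq T (x i) (y i)
      refine ⟨⟨t, 1⟩, ?_⟩
      change baseAut _ _ _ _ = _
      rw [baseAut_ofPoint hg hs]
      congr 1
      funext i
      exact ht i
  rw [h1, Nat.card_range_of_injective hinj, Nat.card_fun, Nat.card_fin]

/-- A criterion for the stabiliser of `ofPoint hg x` to be as small as possible: no two points of
`Ω` can be exchanged in one argument of `g` without changing `g`, and no two points have nested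
stabilisers. -/
theorem ofPoint_injective [MulAction.IsPretransitive T Ω]
    {g : (Fin m → Ω) → T} (hg : IsConjEquivariant g) (hs : IsSymm g)
    (hE : ∀ a b : Ω, (∀ x, g (Function.update x 0 a) = g (Function.update x 0 b)) → a = b)
    (hV : ∀ a b : Ω, (∀ s : T, s • a = a → s • b = b) → a = b) :
    Function.Injective (ofPoint hg) := by
  have hE' : ∀ (j : Fin m) (a b : Ω),
      (∀ x, g (Function.update x j a) = g (Function.update x j b)) → a = b := by
    intro j a b h
    apply hE
    have hu : ∀ (x : Fin m → Ω) (c : Ω), g (Function.update x 0 c) =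
        g (Function.update (x ∘ Equiv.swap 0 j) j c) := by
      intro x c
      rw [← hs (Equiv.swap 0 j) (Function.update x 0 c)]
      congr 1
      funext i
      rcases eq_or_ne i j with rfl | hi
      · simp
      · rw [Function.update_of_ne hi]
        have : Equiv.swap 0 j i ≠ 0 := by
          intro h0
          apply hi
          rw [← Equiv.swap_apply_left (0 : Fin m) j, ← Equiv.symm_apply_eq, Equiv.symm_swap, h0]
        simp [this]
    intro x
    rw [hu, hu, h]
  intro x y hxy
  rw [ofPoint_eq_iff] at hxy
  funext j
  apply hV
  intro s hsx
  apply hE' j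
  intro z
  choose t ht using fun i => MulAction.exists_smul_eq T (y i) (z i)
  have e : ∀ u : T, Function.update z j (u • y j) = Function.update t j u • y := by
    intro u
    funext i
    rcases eq_or_ne i j with rfl | hi
    · simp
    · simp [hi, ht]
  have e' : Function.update t j s • x = Function.update t j 1 • x := by
    funext i
    rcases eq_or_ne i j with rfl | hi
    · simp [hsx]
    · simp [hi]
  have e1 := e 1
  rw [one_smul] at e1
  rw [e s, e1, ← hxy, ← hxy, e']

end Equivariant

/-! ### Subdegrees from conjugacy classes -/

section ConjugacyClass

theorem inv_mul_mem_centralizer_iff {T : Type*} [Group T] {c : T} (s t : T) :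
    s⁻¹ * t ∈ Subgroup.centralizer {c} ↔ s * c * s⁻¹ = t * c * t⁻¹ := by
  rw [Subgroup.mem_centralizer_singleton_iff]
  constructor
  · intro h
    calc s * c * s⁻¹ = s * (c * (s⁻¹ * t)) * t⁻¹ := by group
      _ = s * (s⁻¹ * t * c) * t⁻¹ := by rw [h]
      _ = t * c * t⁻¹ := by group
  · intro h
    calc s⁻¹ * t * c = s⁻¹ * (t * c * t⁻¹) * t := by group
      _ = s⁻¹ * (s * c * s⁻¹) * t := by rw [h]
      _ = c * (s⁻¹ * t) := by group

variable {m : ℕ} [NeZero m] {T Ω : Type*} [Group T]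

open Classical in
/-- The map `Ω ^ m → T` that is given by `ev` on the diagonal and trivial off it. -/
noncomputable def diagonalMap (ev : Ω → T) (x : Fin m → Ω) : T :=
  if ∀ i, x i = x 0 then ev (x 0) else 1

theorem isSymm_diagonalMap (ev : Ω → T) : IsSymm (diagonalMap (m := m) ev) := by
  intro σ x
  unfold diagonalMap
  by_cases h : ∀ i, x i = x 0
  · rw [if_pos h, if_pos (fun i => by simp [h (σ i), h (σ 0)])]
    simp [h (σ 0)]
  · rw [if_neg h, if_neg (fun h' => h fun i => ?_)]
    have h1 : x i = x (σ 0) := by simpa using h' (σ.symm i)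
    have h2 : x 0 = x (σ 0) := by simpa using h' (σ.symm 0)
    rw [h1, h2]

variable [MulAction T Ω]

theorem isConjEquivariant_diagonalMap {ev : Ω → T}
    (hev : ∀ (t : T) a, ev (t • a) = t * ev a * t⁻¹) :
    IsConjEquivariant (diagonalMap (m := m) ev) := by
  intro t x
  unfold diagonalMap
  by_cases h : ∀ i, x i = x 0
  · rw [if_pos h, if_pos (fun i => by simp [h i])]
    exact hev t (x 0)
  · rw [if_neg h, if_neg (fun h' => h fun i => MulAction.injective t (h' i))]
    simp

/-- If `Ω` is the conjugacy class of `c ≠ 1`, seen as cosets of the centraliser, then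
`diagonalMap` gives the subdegree `|Ω| ^ m`. -/
theorem isNontrivialSubdegree_index_centralizer {c : T} (hc : c ≠ 1)
    (α : base (diag m T) (diagConj m T)) :
    IsNontrivialSubdegree (Product (diag m T) (diagConj m T)) α
      ((Subgroup.centralizer {c}).index ^ m) := by
  let ev : T ⧸ Subgroup.centralizer {c} → T := fun a =>
    Quotient.liftOn' a (fun t => t * c * t⁻¹) fun s t h =>
      (inv_mul_mem_centralizer_iff s t).1 (QuotientGroup.leftRel_apply.1 h)
  have hev_mk : ∀ t : T, ev (t : T ⧸ Subgroup.centralizer {c}) = t * c * t⁻¹ := fun _ => rfl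
  have hev : ∀ (t : T) a, ev (t • a) = t * ev a * t⁻¹ := by
    intro t a
    induction a using QuotientGroup.induction_on with
    | H s =>
      change ev ((t * s : T) : T ⧸ Subgroup.centralizer {c}) = _
      rw [hev_mk, hev_mk]
      group
  have hinj : Function.Injective ev := by
    intro a b
    induction a using QuotientGroup.induction_on with
    | H s =>
      induction b using QuotientGroup.induction_on with
      | H t =>
        rw [hev_mk, hev_mk, ← inv_mul_mem_centralizer_iff, QuotientGroup.eq]
        exact id
  have hev1 : ev ((1 : T) : T ⧸ Subgroup.centralizer {c}) = c := by simp [hev_mk]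
  have hx : diagonalMap (m := m) ev (fun _ => ((1 : T) : T ⧸ Subgroup.centralizer {c})) = c := by
    simp [diagonalMap, hev1]
  refine isNontrivialSubdegree_of_injective (isConjEquivariant_diagonalMap hev)
    (isSymm_diagonalMap ev) ?_ (x := fun _ => ((1 : T) : T ⧸ Subgroup.centralizer {c}))
    (by rwa [hx]) α
  intro x y hxy
  rw [ofPoint_eq_iff] at hxy
  -- translate `x` to the constant point with value `c`, where the map detects everything
  choose t ht using fun i =>
    MulAction.exists_smul_eq T (x i) ((1 : T) : T ⧸ Subgroup.centralizer {c})
  have h1 : t • x = fun _ => ((1 : T) : T ⧸ Subgroup.centralizer {c}) := funext ht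
  have h2 := hxy t
  rw [h1, hx] at h2
  unfold diagonalMap at h2
  split_ifs at h2 with h3
  · have h4 := hinj (hev1.trans h2)
    funext i
    apply MulAction.injective (t i)
    change (t • x) i = (t • y) i
    rw [h3 i, ← h4, h1]
  · exact absurd h2 hc

end ConjugacyClass

/-! ### Subdegrees from pairs of points -/

section Pair

variable {m : ℕ} {T Ω : Type*} [Group T] [MulAction T Ω]

/-- Up to a permutation of the coordinates, `x` is the translate by `t` of `(a, b, …, b)`. -/
def IsPairTranslate (a b : Ω) (x : Fin m → Ω) (t : T) : Prop :=
  ∃ j, x j = t • a ∧ ∀ i, i ≠ j → x i = t • b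

theorem IsPairTranslate.smul {a b : Ω} {x : Fin m → Ω} {t : T} (h : IsPairTranslate a b x t)
    (s : T) : IsPairTranslate a b (s • x) (s * t) := by
  obtain ⟨j, h1, h2⟩ := h
  refine ⟨j, ?_, fun i hi => ?_⟩
  · rw [Pi.smul_apply, h1, mul_smul]
  · rw [Pi.smul_apply, h2 i hi, mul_smul]

theorem IsPairTranslate.comp {a b : Ω} {x : Fin m → Ω} {t : T} (h : IsPairTranslate a b x t)
    (σ : Equiv.Perm (Fin m)) : IsPairTranslate a b (x ∘ σ) t := by
  obtain ⟨j, h1, h2⟩ := h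
  refine ⟨σ⁻¹ j, by simpa using h1, fun i hi => h2 _ fun h => hi ?_⟩
  rw [← h]
  simp

open Classical in
/-- The symmetric equivariant map with value `t c t⁻¹` at the translate of `(a, b, …, b)` by `t`,
and trivial elsewhere. The chosen translation does not matter, see `pairMap_eq`. -/
noncomputable def pairMap (a b : Ω) (c : T) (x : Fin m → Ω) : T :=
  if h : ∃ t : T, IsPairTranslate a b x t then h.choose * c * h.choose⁻¹ else 1

theorem exists_isPairTranslate {a b : Ω} {c : T} {x : Fin m → Ω} (h : pairMap a b c x ≠ 1) :
    ∃ t : T, IsPairTranslate a b x t := by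
  by_contra h'
  exact h (dif_neg h')

/-- The value of `pairMap` is well defined: two translations differ by an element that fixes `a` and
`b`, or, for `m = 2` only, interchanges them. -/
theorem pairMap_eq (hm : 2 ≤ m) {a b : Ω} (hab : a ≠ b) {c : T}
    (hc : ∀ u : T, u • a = a → u • b = b → u * c = c * u)
    (hsw : m = 2 → ∀ u : T, u • a = b → u • b = a → u * c = c * u)
    {x : Fin m → Ω} {t : T} (h : IsPairTranslate a b x t) : pairMap a b c x = t * c * t⁻¹ := by
  have hex : ∃ t : T, IsPairTranslate a b x t := ⟨t, h⟩
  unfold pairMap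
  rw [dif_pos hex]
  obtain ⟨k, hk1, hk2⟩ := hex.choose_spec
  generalize hex.choose = s at *
  obtain ⟨j, hj1, hj2⟩ := h
  have key : (t⁻¹ * s) * c = c * (t⁻¹ * s) := by
    rcases eq_or_ne j k with rfl | hjk
    · obtain ⟨i, hi⟩ : ∃ i : Fin m, i ≠ j := by
        have := Fin.nontrivial_iff_two_le.2 hm
        exact exists_ne j
      apply hc
      · rw [mul_smul, ← hk1, hj1, inv_smul_smul]
      · rw [mul_smul, ← hk2 i hi, hj2 i hi, inv_smul_smul]
    · by_cases h2 : m = 2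
      · apply hsw h2
        · rw [mul_smul, ← hk1, hj2 k hjk.symm, inv_smul_smul]
        · rw [mul_smul, ← hk2 j hjk, hj1, inv_smul_smul]
      · -- a third coordinate shows that the two translates differ
        exfalso
        obtain ⟨i, hij, hik⟩ : ∃ i : Fin m, i ≠ j ∧ i ≠ k := by
          have : 2 < (Finset.univ : Finset (Fin m)).card := by
            rw [Finset.card_univ, Fintype.card_fin]; omega
          obtain ⟨i, hi, hi'⟩ := Finset.exists_mem_notMem_of_card_lt_card
            (lt_of_le_of_lt (Finset.card_le_two (a := j) (b := k)) this)
          simp only [Finset.mem_insert, Finset.mem_singleton, not_or] at hi'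
          exact ⟨i, hi'⟩
        have e1 : t • b = s • b := by rw [← hj2 i hij, hk2 i hik]
        have e2 : t • a = s • b := by rw [← hj1, hk2 j hjk]
        exact hab (MulAction.injective t (e2.trans e1.symm))
  calc s * c * s⁻¹ = t * (t⁻¹ * s * c) * s⁻¹ := by group
    _ = t * (c * (t⁻¹ * s)) * s⁻¹ := by rw [key]
    _ = t * c * t⁻¹ := by group

theorem smul_mk_eq_mk_iff {A : Subgroup T} (u s t : T) :
    u • (s : T ⧸ A) = (t : T ⧸ A) ↔ t⁻¹ * u * s ∈ A := by
  rw [eq_comm]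
  change (t : T ⧸ A) = ((u * s : T) : T ⧸ A) ↔ _
  rw [QuotientGroup.eq, mul_assoc]

/-- The hypothesis on nested stabilisers in `ofPoint_injective`, for the action on cosets. -/
theorem eq_of_stabilizer_le {A : Subgroup T}
    (hV : ∀ t, (∀ a ∈ A, t⁻¹ * a * t ∈ A) → t ∈ A) (a b : T ⧸ A)
    (h : ∀ s : T, s • a = a → s • b = b) : a = b := by
  induction a using QuotientGroup.induction_on with
  | H x =>
    induction b using QuotientGroup.induction_on with
    | H y =>
      rw [QuotientGroup.eq]
      apply hV
      intro a ha
      have := h (x * a * x⁻¹) ((smul_mk_eq_mk_iff _ _ _).2 (by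
        rwa [show x⁻¹ * (x * a * x⁻¹) * x = a by group]))
      rw [smul_mk_eq_mk_iff] at this
      rwa [show (x⁻¹ * y)⁻¹ * a * (x⁻¹ * y) = y⁻¹ * (x * a * x⁻¹) * y by group]

/-- A maximal subgroup that is not normal is contained in no other conjugate of itself. -/
theorem mem_of_conj_mem {A : Subgroup T} (hA : IsCoatom A) (hnA : ¬ A.Normal) (t : T)
    (ht : ∀ a ∈ A, t⁻¹ * a * t ∈ A) : t ∈ A := by
  have hB : IsCoatom ((MulAut.conj t⁻¹).mapSubgroup A) :=
    ((MulAut.conj t⁻¹).mapSubgroup.isCoatom_iff A).2 hA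
  have hBA : (MulAut.conj t⁻¹).mapSubgroup A ≤ A := by
    rintro _ ⟨a, ha, rfl⟩
    simpa [MulAut.conj_apply] using ht a ha
  have heq : (MulAut.conj t⁻¹).mapSubgroup A = A := by
    by_contra hne
    exact hA.1 (hB.2 A (lt_of_le_of_ne hBA hne))
  have hn : t ∈ Subgroup.normalizer (A : Set T) := by
    rw [Subgroup.mem_normalizer_iff]
    intro a
    constructor
    · intro ha
      rw [← heq] at ha
      obtain ⟨b, hb, hba⟩ := ha
      have : a = t⁻¹ * b * t := by simpa [MulAut.conj_apply] using hba.symm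
      rw [this, show t * (t⁻¹ * b * t) * t⁻¹ = b by group]
      exact hb
    · intro ha
      have := ht _ ha
      rwa [show t⁻¹ * (t * a * t⁻¹) * t = a by group] at this
  rcases (Subgroup.le_normalizer (H := A)).eq_or_lt with h | h
  · rw [h]
    exact hn
  · exact absurd (Subgroup.normalizer_eq_top_iff.1 (hA.2 _ h)) hnA

theorem isConjEquivariant_pairMap (hm : 2 ≤ m) {a b : Ω} (hab : a ≠ b) {c : T}
    (hc : ∀ u : T, u • a = a → u • b = b → u * c = c * u)
    (hsw : m = 2 → ∀ u : T, u • a = b → u • b = a → u * c = c * u) :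
    IsConjEquivariant (pairMap (m := m) a b c) := by
  intro s x
  by_cases h : ∃ t : T, IsPairTranslate a b x t
  · obtain ⟨t, ht⟩ := h
    rw [pairMap_eq hm hab hc hsw ht, pairMap_eq hm hab hc hsw (ht.smul s)]
    group
  · have h' : ¬ ∃ t : T, IsPairTranslate a b (s • x) t := by
      rintro ⟨t, ht⟩
      refine h ⟨s⁻¹ * t, ?_⟩
      have := ht.smul s⁻¹
      rwa [inv_smul_smul] at this
    unfold pairMap
    rw [dif_neg h, dif_neg h']
    simp

theorem isSymm_pairMap (hm : 2 ≤ m) {a b : Ω} (hab : a ≠ b) {c : T}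
    (hc : ∀ u : T, u • a = a → u • b = b → u * c = c * u)
    (hsw : m = 2 → ∀ u : T, u • a = b → u • b = a → u * c = c * u) :
    IsSymm (pairMap (m := m) a b c) := by
  intro σ x
  by_cases h : ∃ t : T, IsPairTranslate a b x t
  · obtain ⟨t, ht⟩ := h
    rw [pairMap_eq hm hab hc hsw ht, pairMap_eq hm hab hc hsw (ht.comp σ)]
  · have h' : ¬ ∃ t : T, IsPairTranslate a b (x ∘ σ) t := by
      rintro ⟨t, ht⟩
      refine h ⟨t, ?_⟩
      have := ht.comp σ⁻¹
      rwa [Function.comp_assoc, show (σ : Fin m → Fin m) ∘ ⇑σ⁻¹ = id from by ext; simp,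
        Function.comp_id] at this
    unfold pairMap
    rw [dif_neg h, dif_neg h']

variable [NeZero m]

/-- The first argument of `pairMap` is determined by the map when `m ≥ 3`: in
`(a, a', a, …, a)`, with `(a', a)` a translate of the given pair, the first entry can only be
replaced by `a'` without leaving the support, and there is more than one choice of `a'`. -/
theorem pairMap_separates_of_three_le (hm : 3 ≤ m) [MulAction.IsPretransitive T Ω] {a b : Ω}
    (hab : a ≠ b) {c : T} (hc1 : c ≠ 1)
    (hc : ∀ u : T, u • a = a → u • b = b → u * c = c * u)
    (hV : ∀ a b : Ω, (∀ s : T, s • a = a → s • b = b) → a = b) (p q : Ω)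
    (hpq : ∀ x : Fin m → Ω,
      pairMap a b c (Function.update x 0 p) = pairMap a b c (Function.update x 0 q)) : p = q := by
  by_contra hne
  have h10 : (⟨1, by omega⟩ : Fin m) ≠ 0 := by
    rw [Ne, Fin.ext_iff]; simp
  have h20 : (⟨2, by omega⟩ : Fin m) ≠ 0 := by
    rw [Ne, Fin.ext_iff]; simp
  have h21 : (⟨2, by omega⟩ : Fin m) ≠ ⟨1, by omega⟩ := by simp
  have key : ∀ t : T, t • b = p → t • a = q := by
    intro t ht
    have hap : t • a ≠ p := fun h => hab (MulAction.injective t (h.trans ht.symm))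
    set x : Fin m → Ω := Function.update (fun _ => p) ⟨1, by omega⟩ (t • a) with hx
    have hx0 : Function.update x 0 p = x := by
      apply Function.update_eq_self_iff.2
      rw [hx, Function.update_of_ne h10.symm]
    have h1 : IsPairTranslate a b x t :=
      ⟨⟨1, by omega⟩, by rw [hx, Function.update_self],
        fun i hi => by rw [hx, Function.update_of_ne hi, ht]⟩
    have h2 := hpq x
    rw [hx0, pairMap_eq (by omega) hab hc (by omega) h1] at h2
    have h3 : pairMap a b c (Function.update x 0 q) ≠ 1 := by
      rw [← h2]
      simpa using hc1
    obtain ⟨s, k, hk1, hk2⟩ := exists_isPairTranslate h3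
    have v0 : Function.update x 0 q 0 = q := Function.update_self ..
    have v1 : Function.update x 0 q ⟨1, by omega⟩ = t • a := by
      rw [Function.update_of_ne h10, hx, Function.update_self]
    have v2 : Function.update x 0 q ⟨2, by omega⟩ = p := by
      rw [Function.update_of_ne h20, hx, Function.update_of_ne h21]
    by_cases k0 : k = 0
    · subst k0
      have e1 := hk2 _ h10
      have e2 := hk2 _ h20
      rw [v1] at e1
      rw [v2] at e2
      exact absurd (e1.trans e2.symm) hap
    · have e0 := hk2 _ (Ne.symm k0)
      rw [v0] at e0
      by_cases k1 : k = ⟨1, by omega⟩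
      · have e2 := hk2 ⟨2, by omega⟩ (by rw [k1]; exact h21)
        rw [v2] at e2
        exact absurd (e2.trans e0.symm) hne
      · have e1 := hk2 _ (Ne.symm k1)
        rw [v1] at e1
        exact e1.trans e0.symm
  obtain ⟨t, ht⟩ := MulAction.exists_smul_eq T b p
  have hta := key t ht
  apply hne
  apply hV
  intro s hs
  have := key (s * t) (by rw [mul_smul, ht, hs])
  rwa [mul_smul, hta] at this

/-- If `T` is primitive on `Ω`, interchangeability in the first argument of `pairMap` is a
congruence of the action, hence trivial as `pairMap` is not constant. -/
theorem pairMap_separates_of_isPreprimitive (hm : 2 ≤ m) [MulAction.IsPreprimitive T Ω] {a b : Ω}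
    (hab : a ≠ b) {c : T} (hc1 : c ≠ 1)
    (hc : ∀ u : T, u • a = a → u • b = b → u * c = c * u)
    (hsw : m = 2 → ∀ u : T, u • a = b → u • b = a → u * c = c * u) (p q : Ω)
    (hpq : ∀ x : Fin m → Ω,
      pairMap a b c (Function.update x 0 p) = pairMap a b c (Function.update x 0 q)) : p = q := by
  have hequiv := isConjEquivariant_pairMap hm hab hc hsw
  let R : Ω → Ω → Prop := fun p q => ∀ x : Fin m → Ω,
    pairMap a b c (Function.update x 0 p) = pairMap a b c (Function.update x 0 q)
  have hR : ∀ (t : T) (p q : Ω), R p q → R (t • p) (t • q) := by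
    intro t p q h x
    have e : ∀ r : Ω, Function.update x 0 (t • r) = t • Function.update (t⁻¹ • x) 0 r := by
      intro r
      funext i
      rcases eq_or_ne i 0 with rfl | hi
      · simp
      · simp [hi]
    rw [e, e, hequiv, hequiv, h]
  have hblock : MulAction.IsBlock T {r | R p r} := by
    rw [MulAction.isBlock_iff_smul_eq_of_mem]
    intro t r hr htr
    have h1 : R (t • p) p := fun x => ((hR t p r hr x).trans (htr x).symm)
    ext w
    rw [Set.mem_smul_set_iff_inv_smul_mem]
    constructor
    · intro hw x
      have := hR t _ _ hw x
      rw [smul_inv_smul] at this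
      exact (h1 x).symm.trans this
    · intro hw
      have h2 : R (t • p) w := fun x => (h1 x).trans (hw x)
      have := hR t⁻¹ _ _ h2
      rwa [inv_smul_smul] at this
  rcases MulAction.IsPreprimitive.isTrivialBlock_of_isBlock hblock with h | h
  · exact h (fun _ => rfl) hpq
  · exfalso
    have ha : R p a := by
      have : a ∈ {r | R p r} := h ▸ Set.mem_univ a
      exact this
    have hb : R p b := by
      have : b ∈ {r | R p r} := h ▸ Set.mem_univ b
      exact this
    have e := (ha fun _ => b).symm.trans (hb fun _ => b)
    rw [pairMap_eq hm hab hc hsw (t := 1) ⟨0, by simp, fun i hi => by simp [hi]⟩] at e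
    have h3 : pairMap a b c (Function.update (fun _ : Fin m => b) 0 b) ≠ 1 := by
      rw [← e]
      simpa using hc1
    obtain ⟨s, k, hk1, hk2⟩ := exists_isPairTranslate h3
    obtain ⟨i, hi⟩ : ∃ i : Fin m, i ≠ k := by
      have := Fin.nontrivial_iff_two_le.2 hm
      exact exists_ne k
    have h4 := hk2 i hi
    rw [Function.update_eq_self_iff.2 rfl] at h4 hk1
    exact hab (MulAction.injective s (hk1.symm.trans h4))

/-- Let `A` be a subgroup of `T` that is contained in no other conjugate of itself, and let
`c ≠ 1` centralise `A ∩ t₀ A t₀⁻¹` for some `t₀ ∉ A`. If `m ≥ 3`, then `|T : A| ^ m` is a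
subdegree. -/
theorem isNontrivialSubdegree_index_of_three_le (hm : 3 ≤ m) {A : Subgroup T} {t₀ c : T}
    (ht₀ : t₀ ∉ A) (hc1 : c ≠ 1) (hc : ∀ u ∈ A, t₀⁻¹ * u * t₀ ∈ A → u * c = c * u)
    (hV : ∀ t, (∀ a ∈ A, t⁻¹ * a * t ∈ A) → t ∈ A) (α : base (diag m T) (diagConj m T)) :
    IsNontrivialSubdegree (Product (diag m T) (diagConj m T)) α (A.index ^ m) := by
  have hab : ((1 : T) : T ⧸ A) ≠ (t₀ : T ⧸ A) := by
    rw [Ne, QuotientGroup.eq]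
    simpa using ht₀
  have hc' : ∀ u : T, u • ((1 : T) : T ⧸ A) = (1 : T) → u • (t₀ : T ⧸ A) = t₀ →
      u * c = c * u := by
    intro u h1 h2
    rw [smul_mk_eq_mk_iff] at h1 h2
    exact hc u (by simpa using h1) h2
  have hsw : m = 2 → ∀ u : T, u • ((1 : T) : T ⧸ A) = t₀ → u • (t₀ : T ⧸ A) = (1 : T) →
      u * c = c * u := by omega
  refine isNontrivialSubdegree_of_injective
    (isConjEquivariant_pairMap (by omega) hab hc' hsw) (isSymm_pairMap (by omega) hab hc' hsw)
    (ofPoint_injective _ (isSymm_pairMap (by omega) hab hc' hsw)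
      (pairMap_separates_of_three_le hm hab hc1 hc' (eq_of_stabilizer_le hV))
      (eq_of_stabilizer_le hV))
    (x := Function.update (fun _ => (t₀ : T ⧸ A)) 0 ((1 : T) : T ⧸ A)) ?_ α
  rw [pairMap_eq (by omega) hab hc' hsw (t := 1) ⟨0, by simp, fun i hi => by simp [hi]⟩]
  simpa using hc1

/-- Let `A` be a maximal subgroup of `T` that is not normal, and let `c ≠ 1` centralise the setwise
stabiliser of the pair of cosets `{A, t₀ A}` for some `t₀ ∉ A`. Then `|T : A| ^ m` is a
subdegree for all `m ≥ 2`. -/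
theorem isNontrivialSubdegree_index_of_isCoatom (hm : 2 ≤ m) {A : Subgroup T} (hA : IsCoatom A)
    (hnA : ¬ A.Normal) {t₀ c : T}
    (ht₀ : t₀ ∉ A) (hc1 : c ≠ 1) (hc : ∀ u ∈ A, t₀⁻¹ * u * t₀ ∈ A → u * c = c * u)
    (hsw : ∀ u, t₀⁻¹ * u ∈ A → u * t₀ ∈ A → u * c = c * u)
    (α : base (diag m T) (diagConj m T)) :
    IsNontrivialSubdegree (Product (diag m T) (diagConj m T)) α (A.index ^ m) := by
  have hab : ((1 : T) : T ⧸ A) ≠ (t₀ : T ⧸ A) := by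
    rw [Ne, QuotientGroup.eq]
    simpa using ht₀
  have hc' : ∀ u : T, u • ((1 : T) : T ⧸ A) = (1 : T) → u • (t₀ : T ⧸ A) = t₀ →
      u * c = c * u := by
    intro u h1 h2
    rw [smul_mk_eq_mk_iff] at h1 h2
    exact hc u (by simpa using h1) h2
  have hsw' : m = 2 → ∀ u : T, u • ((1 : T) : T ⧸ A) = t₀ → u • (t₀ : T ⧸ A) = (1 : T) →
      u * c = c * u := by
    intro _ u h1 h2
    rw [smul_mk_eq_mk_iff] at h1 h2
    exact hsw u (by simpa using h1) (by simpa using h2)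
  have : Nontrivial (T ⧸ A) := ⟨_, _, hab⟩
  have : MulAction.IsPreprimitive T (T ⧸ A) := by
    rw [← MulAction.isCoatom_stabilizer_iff_preprimitive T ((1 : T) : T ⧸ A)]
    rwa [MulAction.stabilizer_quotient]
  have hV := eq_of_stabilizer_le (mem_of_conj_mem hA hnA)
  refine isNontrivialSubdegree_of_injective
    (isConjEquivariant_pairMap hm hab hc' hsw') (isSymm_pairMap hm hab hc' hsw')
    (ofPoint_injective _ (isSymm_pairMap hm hab hc' hsw')
      (pairMap_separates_of_isPreprimitive hm hab hc1 hc' hsw') hV)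
    (x := Function.update (fun _ => (t₀ : T ⧸ A)) 0 ((1 : T) : T ⧸ A)) ?_ α
  rw [pairMap_eq hm hab hc' hsw' (t := 1) ⟨0, by simp, fun i hi => by simp [hi]⟩]
  simpa using hc1

end Pair

/-! ### Orbits from ordered tuples -/

section OrderedTuple

/-- The index of a subgroup is the size of any set that parametrises its left cosets. -/
theorem _root_.Subgroup.index_eq_card_of_surjective {G X : Type*} [Group G] {A : Subgroup G}
    (f : G → X) (hs : Function.Surjective f) (hf : ∀ s t, f s = f t ↔ s⁻¹ * t ∈ A) :
    A.index = Nat.card X := by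
  refine Nat.card_congr (Equiv.ofBijective (fun a : G ⧸ A => Quotient.liftOn' a f
    fun s t h => (hf s t).2 (QuotientGroup.leftRel_apply.1 h)) ⟨?_, ?_⟩)
  · intro a b
    induction a using QuotientGroup.induction_on with
    | H s =>
      induction b using QuotientGroup.induction_on with
      | H t => exact fun h => QuotientGroup.eq.2 ((hf s t).1 h)
  · intro x
    obtain ⟨s, rfl⟩ := hs x
    exact ⟨(s : G ⧸ A), rfl⟩

variable {m : ℕ} {T Ω : Type*} [Group T] [MulAction T Ω]

open Classical in
/-- The equivariant map with value `t c t⁻¹` at the translate of the tuple `x₀` by `t`, and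
trivial elsewhere. -/
noncomputable def tupleMap (x₀ : Fin m → Ω) (c : T) (x : Fin m → Ω) : T :=
  if h : ∃ t : T, x = t • x₀ then h.choose * c * h.choose⁻¹ else 1

theorem tupleMap_smul {x₀ : Fin m → Ω} {c : T} (hc : ∀ u : T, u • x₀ = x₀ → u * c = c * u)
    (t : T) : tupleMap x₀ c (t • x₀) = t * c * t⁻¹ := by
  have hex : ∃ s : T, t • x₀ = s • x₀ := ⟨t, rfl⟩
  unfold tupleMap
  rw [dif_pos hex]
  have hs := hex.choose_spec
  generalize hex.choose = s at *
  have key := hc (t⁻¹ * s) (by rw [mul_smul, ← hs, inv_smul_smul])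
  calc s * c * s⁻¹ = t * (t⁻¹ * s * c) * s⁻¹ := by group
    _ = t * (c * (t⁻¹ * s)) * s⁻¹ := by rw [key]
    _ = t * c * t⁻¹ := by group

theorem isConjEquivariant_tupleMap {x₀ : Fin m → Ω} {c : T}
    (hc : ∀ u : T, u • x₀ = x₀ → u * c = c * u) : IsConjEquivariant (tupleMap x₀ c) := by
  intro s x
  by_cases h : ∃ t : T, x = t • x₀
  · obtain ⟨t, rfl⟩ := h
    rw [← mul_smul, tupleMap_smul hc, tupleMap_smul hc]
    group
  · have h' : ¬ ∃ t : T, s • x = t • x₀ := by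
      rintro ⟨t, ht⟩
      exact h ⟨s⁻¹ * t, by rw [mul_smul, ← ht, inv_smul_smul]⟩
    unfold tupleMap
    rw [dif_neg h, dif_neg h']
    simp

/-- If `c ≠ 1` centralises the stabiliser of an ordered `m`-tuple, then the element of `N` that it
defines is fixed by a direct product of `m` point stabilisers, without the permutations of the
coordinates. -/
theorem exists_isNontrivialSubdegree_dvd [NeZero m] [MulAction.IsPretransitive T Ω]
    {x₀ : Fin m → Ω} {c : T} (hc1 : c ≠ 1) (hc : ∀ u : T, u • x₀ = x₀ → u * c = c * u)
    (α : base (diag m T) (diagConj m T)) :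
    ∃ d : ℕ, d ∣ m.factorial * Nat.card Ω ^ m ∧
      IsNontrivialSubdegree (Product (diag m T) (diagConj m T)) α d := by
  have hg := isConjEquivariant_tupleMap hc
  have hx : tupleMap x₀ c x₀ = c := by simpa using tupleMap_smul hc 1
  have hne : ofPoint hg x₀ ≠ 1 := ofPoint_ne_one hg (by rwa [hx])
  refine ⟨_, ?_, isNontrivialSubdegree_of_ne_one hne rfl α⟩
  let S : Subgroup (Wr m T) := (MulAction.stabilizer
    (MulAut (base (diag m T) (diagConj m T))) (ofPoint hg x₀)).comap
      (baseAut (diag m T) (diagConj m T))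
  let K : Subgroup (Wr m T) := (MulAction.stabilizer (Fin m → T) x₀).map SemidirectProduct.inl
  have hS : S.index = Nat.card (Set.range fun h : Wr m T =>
      baseAut (diag m T) (diagConj m T) h (ofPoint hg x₀)) := by
    refine Subgroup.index_eq_card_of_surjective _ Set.rangeFactorization_surjective fun s t => ?_
    rw [Subtype.ext_iff, Set.rangeFactorization_coe, Set.rangeFactorization_coe,
      Subgroup.mem_comap, MulAction.mem_stabilizer_iff, map_mul, map_inv,
      MulAut.smul_def, MulAut.mul_apply, MulAut.inv_apply, MulEquiv.symm_apply_eq]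
    exact eq_comm
  have hK : K.index = m.factorial * Nat.card Ω ^ m := by
    rw [Subgroup.index_eq_card_of_surjective (X := Equiv.Perm (Fin m) × (Fin m → Ω))
      (fun h : Wr m T => (h.right, fun i => h.left (h.right i) • x₀ i))]
    · rw [Nat.card_prod, Nat.card_fun, Nat.card_perm, Nat.card_fin]
    · rintro ⟨σ, y⟩
      choose t ht using fun i => MulAction.exists_smul_eq T (x₀ i) (y i)
      refine ⟨⟨fun i => t (σ.symm i), σ⟩, ?_⟩
      simp [ht]
    · rintro ⟨s, σ⟩ ⟨t, τ⟩
      have hleft : ∀ i, ((⟨s, σ⟩ : Wr m T)⁻¹ * ⟨t, τ⟩).left i = (s (σ i))⁻¹ * t (σ i) :=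
        fun _ => rfl
      rw [Prod.mk.injEq, funext_iff, Subgroup.mem_map]
      constructor
      · rintro ⟨rfl : σ = τ, h⟩
        refine ⟨((⟨s, σ⟩ : Wr m T)⁻¹ * ⟨t, σ⟩).left, ?_, ?_⟩
        · rw [MulAction.mem_stabilizer_iff]
          funext i
          rw [Pi.smul_apply', hleft, mul_smul, ← h i, inv_smul_smul]
        · ext1
          · rfl
          · simp
      · rintro ⟨u, hu, hus⟩
        have hr : σ = τ := by
          have := congrArg SemidirectProduct.right hus
          simpa [eq_inv_mul_iff_mul_eq] using this
        subst hr
        refine ⟨rfl, fun i => ?_⟩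
        have h1 : u i = (s (σ i))⁻¹ * t (σ i) := congrFun (congrArg SemidirectProduct.left hus) i
        have h2 : u i • x₀ i = x₀ i := congrFun hu i
        rw [h1, mul_smul, inv_smul_eq_iff] at h2
        exact h2.symm
  have hKS : K ≤ S := by
    rintro _ ⟨s, hs, rfl⟩
    rw [Subgroup.mem_comap, MulAction.mem_stabilizer_iff, MulAut.smul_def]
    apply Subtype.ext
    funext z
    change tupleMap x₀ c (((SemidirectProduct.inl s)⁻¹ * z : Wr m T).left⁻¹ • x₀) =
      tupleMap x₀ c (z.left⁻¹ • x₀)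
    congr 1
    have e : ((SemidirectProduct.inl s)⁻¹ * z : Wr m T).left = s⁻¹ * z.left := by
      simp
    rw [e, mul_inv_rev, inv_inv, mul_smul, MulAction.mem_stabilizer_iff.1 hs]
  rw [← hS, ← hK]
  exact Subgroup.index_dvd_of_le hKS

end OrderedTuple

/-! ### Preimages in a covering group -/

section Lift

variable {m : ℕ} [NeZero m] {S T : Type*} [Group S] [Group T]

/-- `isNontrivialSubdegree_index_of_three_le` in terms of preimages in a group `S` over `T`. -/
theorem isNontrivialSubdegree_index_of_three_le_of_surjective (hm : 3 ≤ m) {π : S →* T}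
    (hπ : Function.Surjective π) {A : Subgroup S} (hker : π.ker ≤ A) {t₀ c : S}
    (ht₀ : t₀ ∉ A) (hc1 : π c ≠ 1) (hc : ∀ u ∈ A, t₀⁻¹ * u * t₀ ∈ A → π (u * c) = π (c * u))
    (hV : ∀ t, (∀ a ∈ A, t⁻¹ * a * t ∈ A) → t ∈ A) (α : base (diag m T) (diagConj m T)) :
    IsNontrivialSubdegree (Product (diag m T) (diagConj m T)) α (A.index ^ m) := by
  have hmem : ∀ s : S, π s ∈ A.map π ↔ s ∈ A := by
    intro s
    rw [← Subgroup.mem_comap, Subgroup.comap_map_eq_self hker]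
  have hidx : A.index = (A.map π).index := by
    rw [← Subgroup.index_comap_of_surjective _ hπ, Subgroup.comap_map_eq_self hker]
  rw [hidx]
  refine isNontrivialSubdegree_index_of_three_le hm (t₀ := π t₀) (c := π c)
    (by rwa [hmem]) hc1 ?_ ?_ α
  · rw [hπ.forall]
    intro u hu hu'
    rw [← map_inv, ← map_mul, ← map_mul, hmem] at hu'
    rw [← map_mul, ← map_mul]
    exact hc u ((hmem u).1 hu) hu'
  · rw [hπ.forall]
    intro t ht
    refine (hmem t).2 (hV t fun a ha => ?_)
    rw [← hmem]
    simpa using ht (π a) ((hmem a).2 ha)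

/-- `isNontrivialSubdegree_index_of_isCoatom` in terms of preimages in a group `S` over `T`. -/
theorem isNontrivialSubdegree_index_of_isCoatom_of_surjective (hm : 2 ≤ m) {π : S →* T}
    (hπ : Function.Surjective π) {A : Subgroup S} (hker : π.ker ≤ A) (hA : IsCoatom A) {t₀ c : S}
    (hnA : ∃ a ∈ A, t₀⁻¹ * a * t₀ ∉ A) (hc1 : π c ≠ 1)
    (hc : ∀ u ∈ A, t₀⁻¹ * u * t₀ ∈ A → π (u * c) = π (c * u))
    (hsw : ∀ u, t₀⁻¹ * u ∈ A → u * t₀ ∈ A → π (u * c) = π (c * u))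
    (α : base (diag m T) (diagConj m T)) :
    IsNontrivialSubdegree (Product (diag m T) (diagConj m T)) α (A.index ^ m) := by
  have hmem : ∀ s : S, π s ∈ A.map π ↔ s ∈ A := by
    intro s
    rw [← Subgroup.mem_comap, Subgroup.comap_map_eq_self hker]
  have hidx : A.index = (A.map π).index := by
    rw [← Subgroup.index_comap_of_surjective _ hπ, Subgroup.comap_map_eq_self hker]
  obtain ⟨a, ha, hat⟩ := hnA
  have hcoatom : IsCoatom (A.map π) := by
    refine ⟨fun h => hA.1 ?_, fun B hB => ?_⟩
    · rw [← Subgroup.comap_map_eq_self hker, h, Subgroup.comap_top]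
    · have h1 : A < B.comap π := by
        refine lt_of_le_of_ne (Subgroup.map_le_iff_le_comap.1 hB.le) fun h => hB.ne ?_
        rw [h, Subgroup.map_comap_eq_self_of_surjective hπ]
      rw [← Subgroup.map_comap_eq_self_of_surjective hπ B, hA.2 _ h1,
        Subgroup.map_top_of_surjective _ hπ]
  rw [hidx]
  refine isNontrivialSubdegree_index_of_isCoatom hm hcoatom ?_ (t₀ := π t₀) (c := π c)
    ?_ hc1 ?_ ?_ α
  · intro hn
    apply hat
    rw [← hmem]
    simpa using hn.conj_mem _ ((hmem a).2 ha) (π t₀)⁻¹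
  · rw [hmem]
    exact fun h => hat (A.mul_mem (A.mul_mem (A.inv_mem h) ha) h)
  · rw [hπ.forall]
    intro u hu hu'
    rw [← map_inv, ← map_mul, ← map_mul, hmem] at hu'
    rw [← map_mul, ← map_mul]
    exact hc u ((hmem u).1 hu) hu'
  · rw [hπ.forall]
    intro u hu hu'
    rw [← map_inv, ← map_mul, hmem] at hu
    rw [← map_mul, hmem] at hu'
    rw [← map_mul, ← map_mul]
    exact hsw u hu hu'

end Lift

/-! ### Matrices in `SL(2, F)` -/

section SL

variable {F : Type*} [Field F]

theorem sl_ext {s t : SL(2, F)} (h00 : s 0 0 = t 0 0) (h01 : s 0 1 = t 0 1) (h10 : s 1 0 = t 1 0)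
    (h11 : s 1 1 = t 1 1) : s = t := by
  ext i j
  fin_cases i <;> fin_cases j <;> assumption

theorem sl_mul_apply (s t : SL(2, F)) (i j : Fin 2) :
    (s * t) i j = s i 0 * t 0 j + s i 1 * t 1 j := by
  rw [Matrix.SpecialLinearGroup.coe_mul, Matrix.mul_apply, Fin.sum_univ_two]

theorem sl_det (s : SL(2, F)) : s 0 0 * s 1 1 - s 0 1 * s 1 0 = 1 := by
  rw [← Matrix.det_fin_two, s.2]

theorem sl_inv_apply (s : SL(2, F)) : s⁻¹ 0 0 = s 1 1 ∧ s⁻¹ 0 1 = - s 0 1 ∧ s⁻¹ 1 0 = - s 1 0 ∧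
    s⁻¹ 1 1 = s 0 0 := by
  rw [Matrix.SpecialLinearGroup.SL2_inv_expl]
  exact ⟨rfl, rfl, rfl, rfl⟩

/-- The element of `SL(2, F)` with given entries. -/
def slMk (a b c d : F) (h : a * d - b * c = 1) : SL(2, F) :=
  ⟨!![a, b; c, d], by rw [Matrix.det_fin_two_of, h]⟩

theorem slMk_apply (a b c d : F) (h : a * d - b * c = 1) :
    slMk a b c d h 0 0 = a ∧ slMk a b c d h 0 1 = b ∧ slMk a b c d h 1 0 = c ∧
      slMk a b c d h 1 1 = d := ⟨rfl, rfl, rfl, rfl⟩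

theorem sl_neg_apply (s : SL(2, F)) (i j : Fin 2) : (-s) i j = - s i j := rfl

theorem sl_one_apply : (1 : SL(2, F)) 0 0 = 1 ∧ (1 : SL(2, F)) 0 1 = 0 ∧ (1 : SL(2, F)) 1 0 = 0 ∧
    (1 : SL(2, F)) 1 1 = 1 := by simp

/-- The projection of `SL(2, F)` onto `PSL(2, F)`. -/
def toPSL (F : Type*) [Field F] : SL(2, F) →* PSL(2, F) :=
  QuotientGroup.mk' (Subgroup.center SL(2, F))

theorem toPSL_surjective : Function.Surjective (toPSL F) := QuotientGroup.mk'_surjective _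

theorem toPSL_eq_one_iff {s : SL(2, F)} : toPSL F s = 1 ↔ s = 1 ∨ s = -1 := by
  rw [toPSL, QuotientGroup.mk'_apply, QuotientGroup.eq_one_iff]
  constructor
  · intro h
    rw [Matrix.SpecialLinearGroup.mem_center_iff] at h
    obtain ⟨r, hr, hs⟩ := h
    rw [Fintype.card_fin, sq, mul_self_eq_one_iff] at hr
    rcases hr with rfl | rfl
    · left
      apply Subtype.ext
      rw [← hs]
      simp
    · right
      apply Subtype.ext
      rw [← hs]
      ext i j
      fin_cases i <;> fin_cases j <;> simp
  · rintro (rfl | rfl)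
    · exact one_mem _
    · rw [Subgroup.mem_center_iff]
      intro g
      simp

theorem toPSL_eq_iff {s t : SL(2, F)} : toPSL F s = toPSL F t ↔ s = t ∨ s = -t := by
  rw [← mul_inv_eq_one, ← map_inv, ← map_mul, toPSL_eq_one_iff, mul_inv_eq_one,
    mul_inv_eq_iff_eq_mul, neg_one_mul]

end SL

/-! ### The Borel subgroup -/

section Borel

variable {F : Type*} [Field F]

/-- The subgroup of upper triangular matrices, the stabiliser of a point of the projective line. -/
def borel (F : Type*) [Field F] : Subgroup SL(2, F) where
  carrier := {s | s 1 0 = 0}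
  one_mem' := by simp
  mul_mem' := by
    intro s t (hs : s 1 0 = 0) (ht : t 1 0 = 0)
    change (s * t) 1 0 = 0
    rw [sl_mul_apply, hs, ht]
    simp
  inv_mem' := by
    intro s (hs : s 1 0 = 0)
    change s⁻¹ 1 0 = 0
    rw [(sl_inv_apply s).2.2.1, hs, neg_zero]

theorem mem_borel {s : SL(2, F)} : s ∈ borel F ↔ s 1 0 = 0 := Iff.rfl

theorem ker_toPSL_le_iff {A : Subgroup SL(2, F)} : (toPSL F).ker ≤ A ↔ -1 ∈ A := by
  constructor
  · intro h
    exact h (MonoidHom.mem_ker.2 (toPSL_eq_one_iff.2 (Or.inr rfl)))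
  · intro h s hs
    rcases toPSL_eq_one_iff.1 (MonoidHom.mem_ker.1 hs) with rfl | rfl
    · exact A.one_mem
    · exact h

theorem ker_toPSL_le_borel : (toPSL F).ker ≤ borel F := by
  rw [ker_toPSL_le_iff, mem_borel, sl_neg_apply]
  simp

theorem inv_mul_mem_borel_iff {s t : SL(2, F)} :
    s⁻¹ * t ∈ borel F ↔ s 0 0 * t 1 0 = s 1 0 * t 0 0 := by
  rw [mem_borel, sl_mul_apply, (sl_inv_apply s).2.2.1, (sl_inv_apply s).2.2.2]
  constructor
  · intro h; linear_combination h
  · intro h; linear_combination h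

open Classical in
theorem index_borel [Finite F] : (borel F).index = Nat.card F + 1 := by
  rw [← Finite.card_option]
  refine Subgroup.index_eq_card_of_surjective
    (fun s => if s 1 0 = 0 then none else some (s 0 0 / s 1 0)) ?_ ?_
  · rintro (_ | x)
    · exact ⟨1, by simp⟩
    · refine ⟨slMk x (-1) 1 0 (by ring), ?_⟩
      obtain ⟨h1, h2, h3, h4⟩ := slMk_apply x (-1) 1 0 (by ring)
      simp [h1, h3]
  · intro s t
    rw [inv_mul_mem_borel_iff]
    have hs := sl_det s
    have ht := sl_det t
    by_cases h1 : s 1 0 = 0 <;> by_cases h2 : t 1 0 = 0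
    · simp [h1, h2]
    · have : s 0 0 ≠ 0 := by
        intro h
        rw [h, h1] at hs
        simp at hs
      simp [h1, h2, this]
    · have : t 0 0 ≠ 0 := by
        intro h
        rw [h, h2] at ht
        simp at ht
      simp [h1, h2, this]
    · rw [if_neg h1, if_neg h2, Option.some_inj, div_eq_div_iff h1 h2, mul_comm (t 0 0)]

/-- The matrix that interchanges the coordinate axes. -/
def weyl (F : Type*) [Field F] : SL(2, F) := slMk 0 (-1) 1 0 (by ring)

theorem weyl_apply : weyl F 0 0 = 0 ∧ weyl F 0 1 = -1 ∧ weyl F 1 0 = 1 ∧ weyl F 1 1 = 0 :=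
  slMk_apply _ _ _ _ _

theorem weyl_notMem_borel : weyl F ∉ borel F := by
  rw [mem_borel, weyl_apply.2.2.1]
  exact one_ne_zero

/-- The Bruhat decomposition: the complement of the Borel subgroup is one double coset. -/
theorem exists_eq_mul_weyl_mul {s : SL(2, F)} (hs : s ∉ borel F) :
    ∃ a ∈ borel F, ∃ b ∈ borel F, s = a * weyl F * b := by
  rw [mem_borel] at hs
  have hd := sl_det s
  refine ⟨slMk 1 (s 0 0 / s 1 0) 0 1 (by ring), rfl,
    slMk (s 1 0) (s 1 1) 0 (s 1 0)⁻¹ (by rw [mul_inv_cancel₀ hs]; ring), rfl, ?_⟩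
  obtain ⟨w1, w2, w3, w4⟩ := weyl_apply (F := F)
  obtain ⟨a1, a2, a3, a4⟩ := slMk_apply 1 (s 0 0 / s 1 0) 0 1 (by ring)
  obtain ⟨b1, b2, b3, b4⟩ := slMk_apply (s 1 0) (s 1 1) 0 (s 1 0)⁻¹
    (by rw [mul_inv_cancel₀ hs]; ring)
  apply sl_ext <;>
    simp only [sl_mul_apply, w1, w2, w3, w4, a1, a2, a3, a4, b1, b2, b3, b4]
  · field_simp
    ring
  · field_simp
    linear_combination -s 1 0 * hd
  · ring
  · ring

theorem isCoatom_borel : IsCoatom (borel F) := by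
  refine ⟨fun h => weyl_notMem_borel (h ▸ Subgroup.mem_top _), fun B hB => ?_⟩
  obtain ⟨s, hsB, hs⟩ := SetLike.exists_of_lt hB
  obtain ⟨a, ha, b, hb, rfl⟩ := exists_eq_mul_weyl_mul hs
  have hw : weyl F ∈ B := by
    have := B.mul_mem (B.mul_mem (B.inv_mem (hB.le ha)) hsB) (B.inv_mem (hB.le hb))
    rwa [show a⁻¹ * (a * weyl F * b) * b⁻¹ = weyl F by group] at this
  rw [eq_top_iff]
  intro t _
  by_cases ht : t ∈ borel F
  · exact hB.le ht
  · obtain ⟨a, ha, b, hb, rfl⟩ := exists_eq_mul_weyl_mul ht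
    exact B.mul_mem (B.mul_mem (hB.le ha) hw) (hB.le hb)

/-- The Borel subgroup is contained in no other conjugate of itself. -/
theorem mem_borel_of_conj_mem (t : SL(2, F)) (ht : ∀ a ∈ borel F, t⁻¹ * a * t ∈ borel F) :
    t ∈ borel F := by
  have h := ht (slMk 1 1 0 1 (by ring)) rfl
  rw [mul_assoc, inv_mul_mem_borel_iff, sl_mul_apply, sl_mul_apply] at h
  obtain ⟨a1, a2, a3, a4⟩ := slMk_apply (F := F) 1 1 0 1 (by ring)
  rw [a1, a2, a3, a4] at h
  rw [mem_borel]
  have : t 1 0 ^ 2 = 0 := by linear_combination -h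
  exact pow_eq_zero_iff two_ne_zero |>.1 this

/-- The diagonal matrix with entries `a` and `a⁻¹`. -/
def torus {a : F} (ha : a ≠ 0) : SL(2, F) := slMk a 0 0 a⁻¹ (by rw [mul_inv_cancel₀ ha]; ring)

theorem torus_apply {a : F} (ha : a ≠ 0) : torus ha 0 0 = a ∧ torus ha 0 1 = 0 ∧
    torus ha 1 0 = 0 ∧ torus ha 1 1 = a⁻¹ := slMk_apply _ _ _ _ _

theorem toPSL_torus_ne_one {a : F} (ha : a ≠ 0) (ha2 : a ^ 2 ≠ 1) :
    toPSL F (torus ha) ≠ 1 := by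
  rw [Ne, toPSL_eq_one_iff]
  rintro (h | h)
  · have := congrArg (fun s : SL(2, F) => s 0 0) h
    simp only [(torus_apply ha).1, sl_one_apply.1] at this
    exact ha2 (by rw [this]; ring)
  · have := congrArg (fun s : SL(2, F) => s 0 0) h
    simp only [(torus_apply ha).1, sl_one_apply.1, sl_neg_apply] at this
    exact ha2 (by rw [this]; ring)

/-- The stabiliser of the two coordinate axes consists of diagonal matrices, which commute. -/
theorem torus_comm {a : F} (ha : a ≠ 0) (u : SL(2, F)) (hu : u ∈ borel F)
    (hu' : (weyl F)⁻¹ * u * weyl F ∈ borel F) : u * torus ha = torus ha * u := by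
  obtain ⟨w1, w2, w3, w4⟩ := weyl_apply (F := F)
  obtain ⟨t1, t2, t3, t4⟩ := torus_apply ha
  rw [mul_assoc, inv_mul_mem_borel_iff] at hu'
  simp only [sl_mul_apply, w1, w3] at hu'
  have h01 : u 0 1 = 0 := by linear_combination -hu'
  rw [mem_borel] at hu
  apply sl_ext <;> simp only [sl_mul_apply, t1, t2, t3, t4, hu, h01] <;> ring

/-- If `a ^ 2 = -1`, an element that interchanges the coordinate axes commutes with the diagonal
matrix up to sign. -/
theorem torus_comm_of_swap {a : F} (ha : a ≠ 0) (ha2 : a ^ 2 = -1) (u : SL(2, F))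
    (hu : (weyl F)⁻¹ * u ∈ borel F) (hu' : u * weyl F ∈ borel F) :
    u * torus ha = -(torus ha * u) := by
  obtain ⟨w1, w2, w3, w4⟩ := weyl_apply (F := F)
  obtain ⟨t1, t2, t3, t4⟩ := torus_apply ha
  rw [inv_mul_mem_borel_iff] at hu
  rw [mem_borel] at hu'
  simp only [sl_mul_apply, w1, w3] at hu hu'
  have h00 : u 0 0 = 0 := by linear_combination -hu
  have h11 : u 1 1 = 0 := by linear_combination hu'
  have hinv : a⁻¹ = -a := by
    rw [inv_eq_iff_eq_inv]
    refine eq_inv_of_mul_eq_one_left ?_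
    linear_combination -ha2
  apply sl_ext <;> simp only [sl_mul_apply, sl_neg_apply, t1, t2, t3, t4, h00, h11, hinv] <;> ring

theorem exists_ne_zero_sq_ne_one [Finite F] (hF : 4 ≤ Nat.card F) : ∃ a : F, a ≠ 0 ∧ a ^ 2 ≠ 1 := by
  classical
  have := Fintype.ofFinite F
  rw [Nat.card_eq_fintype_card, ← Finset.card_univ] at hF
  obtain ⟨a, -, ha⟩ := Finset.exists_mem_notMem_of_card_lt_card
    (lt_of_le_of_lt (Finset.card_le_three (a := (0 : F)) (b := 1) (c := -1)) hF)
  simp only [Finset.mem_insert, Finset.mem_singleton, not_or] at ha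
  refine ⟨a, ha.1, fun h => ?_⟩
  rw [sq, mul_self_eq_one_iff] at h
  tauto

variable {m : ℕ} [NeZero m] [Finite F]

/-- For `m ≥ 3` any element of the split torus can serve as `c`. -/
theorem isNontrivialSubdegree_borel_of_three_le (hm : 3 ≤ m) (hF : 4 ≤ Nat.card F)
    (α : Points m F) : IsNontrivialSubdegree (G m F) α ((Nat.card F + 1) ^ m) := by
  obtain ⟨a, ha, ha2⟩ := exists_ne_zero_sq_ne_one hF
  rw [← index_borel]
  exact isNontrivialSubdegree_index_of_three_le_of_surjective hm toPSL_surjective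
    ker_toPSL_le_borel weyl_notMem_borel (toPSL_torus_ne_one ha ha2)
    (fun u hu hu' => by rw [torus_comm ha u hu hu']) mem_borel_of_conj_mem α

/-- If `-1` is a square, the split torus has an involution, which commutes with the setwise
stabiliser of the pair of its fixed points. -/
theorem isNontrivialSubdegree_borel_of_sq_eq_neg_one (hm : 2 ≤ m) (h2 : (2 : F) ≠ 0) {a : F}
    (ha2 : a ^ 2 = -1) (α : Points m F) :
    IsNontrivialSubdegree (G m F) α ((Nat.card F + 1) ^ m) := by
  have ha : a ≠ 0 := by
    rintro rfl
    simp at ha2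
  have ha2' : a ^ 2 ≠ 1 := by
    intro h
    apply h2
    linear_combination ha2 - h
  rw [← index_borel]
  refine isNontrivialSubdegree_index_of_isCoatom_of_surjective hm toPSL_surjective
    ker_toPSL_le_borel isCoatom_borel (t₀ := weyl F) ?_ (toPSL_torus_ne_one ha ha2')
    (fun u hu hu' => by rw [torus_comm ha u hu hu'])
    (fun u hu hu' => toPSL_eq_iff.2 (Or.inr (torus_comm_of_swap ha ha2 u hu hu'))) α
  by_contra! h
  exact weyl_notMem_borel (mem_borel_of_conj_mem _ h)

/-- Without a condition on `q` or `m ≥ 3`, ordered pairs of points of the projective line are used. -/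
theorem exists_dvd_isNontrivialSubdegree_borel (hm : 2 ≤ m) (hF : 4 ≤ Nat.card F)
    (α : Points m F) :
    ∃ d, d ∣ m.factorial * (Nat.card F + 1) ^ m ∧ IsNontrivialSubdegree (G m F) α d := by
  obtain ⟨a, ha, ha2⟩ := exists_ne_zero_sq_ne_one hF
  let A : Subgroup PSL(2, F) := (borel F).map (toPSL F)
  have hmem : ∀ s, toPSL F s ∈ A ↔ s ∈ borel F := by
    intro s
    rw [← Subgroup.mem_comap, Subgroup.comap_map_eq_self ker_toPSL_le_borel]
  have hidx : Nat.card (PSL(2, F) ⧸ A) = Nat.card F + 1 := by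
    rw [← index_borel, ← Subgroup.comap_map_eq_self (ker_toPSL_le_borel (F := F)),
      Subgroup.index_comap_of_surjective _ toPSL_surjective]
    rfl
  rw [← hidx]
  refine exists_isNontrivialSubdegree_dvd
    (x₀ := fun i : Fin m => if i = 0 then ((1 : PSL(2, F)) : PSL(2, F) ⧸ A)
      else (toPSL F (weyl F) : PSL(2, F) ⧸ A)) (toPSL_torus_ne_one ha ha2) ?_ α
  rw [toPSL_surjective.forall]
  intro u hu
  have h0 := congrFun hu 0
  have h1 := congrFun hu ⟨1, by omega⟩
  rw [Pi.smul_apply, if_neg (by rw [Fin.ext_iff]; simp), smul_mk_eq_mk_iff, ← map_inv, ← map_mul,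
    ← map_mul, hmem] at h1
  rw [Pi.smul_apply, if_pos rfl, smul_mk_eq_mk_iff, inv_one, one_mul, mul_one, hmem] at h0
  rw [← map_mul, ← map_mul, torus_comm ha u h0 h1]

end Borel

/-! ### Nonsplit tori and their normalisers -/

section Elliptic

variable {F : Type*} [Field F]

/-- The companion matrix of `X ^ 2 - τ X + 1`. -/
def companion (τ : F) : SL(2, F) := slMk 0 (-1) 1 τ (by ring)

theorem companion_apply (τ : F) : companion τ 0 0 = 0 ∧ companion τ 0 1 = -1 ∧
    companion τ 1 0 = 1 ∧ companion τ 1 1 = τ := slMk_apply _ _ _ _ _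

theorem companion_inv_apply (τ : F) : (companion τ)⁻¹ 0 0 = τ ∧ (companion τ)⁻¹ 0 1 = 1 ∧
    (companion τ)⁻¹ 1 0 = -1 ∧ (companion τ)⁻¹ 1 1 = 0 := by
  obtain ⟨h1, h2, h3, h4⟩ := sl_inv_apply (companion τ)
  obtain ⟨c1, c2, c3, c4⟩ := companion_apply τ
  rw [h1, h2, h3, h4, c1, c2, c3, c4, neg_neg]
  exact ⟨rfl, rfl, rfl, rfl⟩

theorem trace_conj (t s : SL(2, F)) :
    (t * s * t⁻¹) 0 0 + (t * s * t⁻¹) 1 1 = s 0 0 + s 1 1 := by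
  obtain ⟨h1, h2, h3, h4⟩ := sl_inv_apply t
  simp only [sl_mul_apply, h1, h2, h3, h4]
  linear_combination (s 0 0 + s 1 1) * sl_det t

theorem lowerLeft_ne_zero {τ : F} (hτ : ∀ x : F, x ^ 2 - τ * x + 1 ≠ 0) {s : SL(2, F)}
    (hs : s 0 0 + s 1 1 = τ) : s 1 0 ≠ 0 := by
  intro h
  apply hτ (s 0 0)
  have := sl_det s
  rw [h] at this
  linear_combination s 0 0 * hs - this

/-- If `X ^ 2 - τ X + 1` is irreducible, there are `q (q - 1)` matrices in `SL(2, q)` of trace `τ`: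
the entries of the first column are arbitrary, except that the lower one is not zero. -/
theorem card_trace_eq [Finite F] {τ : F} (hτ : ∀ x : F, x ^ 2 - τ * x + 1 ≠ 0) :
    Nat.card {s : SL(2, F) // s 0 0 + s 1 1 = τ} = Nat.card F * (Nat.card F - 1) := by
  have hu : Nat.card Fˣ = Nat.card F - 1 := by
    rw [Nat.card_eq_card_units_add_one F]
    rfl
  rw [← hu, ← Nat.card_prod]
  refine Nat.card_congr (Equiv.ofBijective
    (fun s => (s.1 0 0, Units.mk0 (s.1 1 0) (lowerLeft_ne_zero hτ s.2))) ⟨?_, ?_⟩)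
  · rintro ⟨s, hs⟩ ⟨t, ht⟩ h
    rw [Prod.mk.injEq, Units.mk0_inj] at h
    obtain ⟨h00, h10⟩ := h
    simp only at h00 h10
    have h11 : s 1 1 = t 1 1 := by linear_combination hs - ht - h00
    have hz := lowerLeft_ne_zero hτ ht
    apply Subtype.ext
    refine sl_ext h00 (mul_right_cancel₀ hz ?_) h10 h11
    have h1 := sl_det s
    have h2 := sl_det t
    rw [h00, h10, h11] at h1
    linear_combination h2 - h1
  · rintro ⟨x, z⟩
    have hdet : x * (τ - x) - (x * (τ - x) - 1) / z * z = 1 := by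
      rw [div_mul_cancel₀ _ z.ne_zero]
      ring
    obtain ⟨h1, h2, h3, h4⟩ := slMk_apply x ((x * (τ - x) - 1) / z) z (τ - x) hdet
    refine ⟨⟨slMk x ((x * (τ - x) - 1) / z) z (τ - x) hdet, by rw [h1, h4]; ring⟩, ?_⟩
    ext <;> rfl

/-- A matrix of trace `τ` is conjugate to the companion matrix in `GL(2, F)`, by a matrix whose
determinant can be scaled to one if the lower left entry is a square. -/
theorem exists_conj_companion_of_isSquare {τ : F} {s : SL(2, F)} (hs : s 0 0 + s 1 1 = τ)
    (hs0 : s 1 0 ≠ 0) (hsq : IsSquare (s 1 0)) : ∃ t, t * companion τ * t⁻¹ = s := by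
  obtain ⟨w, hw⟩ := hsq
  have hw0 : w ≠ 0 := by
    rintro rfl
    exact hs0 (by rw [hw, mul_zero])
  -- the columns of the conjugating matrix are proportional to `e` and `s e`
  have hdet : w⁻¹ * w - s 0 0 / w * 0 = 1 := by rw [inv_mul_cancel₀ hw0]; ring
  refine ⟨slMk w⁻¹ (s 0 0 / w) 0 w hdet, ?_⟩
  obtain ⟨t1, t2, t3, t4⟩ := slMk_apply w⁻¹ (s 0 0 / w) 0 w hdet
  obtain ⟨c1, c2, c3, c4⟩ := companion_apply τ
  have hd := sl_det s
  rw [mul_inv_eq_iff_eq_mul]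
  apply sl_ext <;> simp only [sl_mul_apply, t1, t2, t3, t4, c1, c2, c3, c4]
  · field_simp
    ring
  · field_simp
    rw [hw] at hd
    linear_combination hd - s 0 0 * hs
  · rw [hw]
    field_simp
    ring
  · rw [hw]
    field_simp
    linear_combination - w * hs

/-- The subgroup of all elements that centralise or invert `c`. -/
def extCentralizer {G : Type*} [Group G] (c : G) : Subgroup G where
  carrier := {s | s * c * s⁻¹ = c ∨ s * c * s⁻¹ = c⁻¹}
  one_mem' := by simp
  mul_mem' := by
    rintro s t (hs | hs) (ht | ht)
    · left
      rw [mul_inv_rev, show s * t * c * (t⁻¹ * s⁻¹) = s * (t * c * t⁻¹) * s⁻¹ by group, ht, hs]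
    · right
      rw [mul_inv_rev, show s * t * c * (t⁻¹ * s⁻¹) = s * (t * c * t⁻¹) * s⁻¹ by group, ht,
        ← conj_inv, hs]
    · right
      rw [mul_inv_rev, show s * t * c * (t⁻¹ * s⁻¹) = s * (t * c * t⁻¹) * s⁻¹ by group, ht, hs]
    · left
      rw [mul_inv_rev, show s * t * c * (t⁻¹ * s⁻¹) = s * (t * c * t⁻¹) * s⁻¹ by group, ht,
        ← conj_inv, hs, inv_inv]
  inv_mem' := by
    rintro s (hs | hs)
    · left
      nth_rw 1 [← hs]
      group
    · right
      have h : s * c⁻¹ * s⁻¹ = c := by rw [← conj_inv, hs, inv_inv]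
      nth_rw 1 [← h]
      group

theorem mem_extCentralizer {G : Type*} [Group G] {c s : G} :
    s ∈ extCentralizer c ↔ s * c * s⁻¹ = c ∨ s * c * s⁻¹ = c⁻¹ := Iff.rfl

theorem conj_mem_extCentralizer_iff {G : Type*} [Group G] {c u t : G} :
    t⁻¹ * u * t ∈ extCentralizer c ↔ u ∈ extCentralizer (t * c * t⁻¹) := by
  rw [mem_extCentralizer, mem_extCentralizer, conj_inv]
  have e : t⁻¹ * u * t * c * (t⁻¹ * u * t)⁻¹ = t⁻¹ * (u * (t * c * t⁻¹) * u⁻¹) * t := by group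
  rw [e]
  have key : ∀ y z : G, t⁻¹ * y * t = z ↔ y = t * z * t⁻¹ := by
    intro y z
    rw [mul_assoc, inv_mul_eq_iff_eq_mul, eq_mul_inv_iff_mul_eq]
  rw [key, key]

theorem companion_zero_inv : (companion (0 : F))⁻¹ = -companion 0 := by
  obtain ⟨c1, c2, c3, c4⟩ := companion_apply (0 : F)
  obtain ⟨d1, d2, d3, d4⟩ := companion_inv_apply (0 : F)
  apply sl_ext <;> simp only [sl_neg_apply, c1, c2, c3, c4, d1, d2, d3, d4] <;> ring

theorem centralizer_companion_apply {τ : F} {u : SL(2, F)}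
    (hu : u * companion τ = companion τ * u) :
    u 0 1 = - u 1 0 ∧ u 1 1 = u 0 0 + τ * u 1 0 := by
  obtain ⟨c1, c2, c3, c4⟩ := companion_apply τ
  have h1 := congrArg (fun s : SL(2, F) => s 0 0) hu
  have h2 := congrArg (fun s : SL(2, F) => s 1 0) hu
  simp only [sl_mul_apply, c1, c2, c3, c4] at h1 h2
  constructor
  · linear_combination h1
  · linear_combination h2

/-- A nonscalar element of the torus generates the same algebra as the companion matrix. -/
theorem commute_companion_of_commute {τ : F} {x d : SL(2, F)}
    (hx : x * companion τ = companion τ * x) (h10 : x 1 0 ≠ 0) (hd : x * d = d * x) :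
    d * companion τ = companion τ * d := by
  obtain ⟨c1, c2, c3, c4⟩ := companion_apply τ
  obtain ⟨e1, e2⟩ := centralizer_companion_apply hx
  have h00 := congrArg (fun s : SL(2, F) => s 0 0) hd
  have h01 := congrArg (fun s : SL(2, F) => s 0 1) hd
  have h10' := congrArg (fun s : SL(2, F) => s 1 0) hd
  have h11 := congrArg (fun s : SL(2, F) => s 1 1) hd
  simp only [sl_mul_apply, e1, e2] at h00 h01 h10' h11
  apply sl_ext <;> simp only [sl_mul_apply, c1, c2, c3, c4] <;> apply mul_left_cancel₀ h10
  · linear_combination -h00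
  · linear_combination -h01
  · linear_combination -h10'
  · linear_combination -h11

/-- The index of the centraliser of a companion matrix whose trace determines its conjugacy
class. -/
theorem index_centralizer_companion [Finite F] {τ : F} (hτ : ∀ x : F, x ^ 2 - τ * x + 1 ≠ 0)
    (hconj : ∀ s : SL(2, F), s 0 0 + s 1 1 = τ → ∃ t, t * companion τ * t⁻¹ = s) :
    (Subgroup.centralizer {companion τ}).index = Nat.card F * (Nat.card F - 1) := by
  rw [← card_trace_eq hτ]
  refine Subgroup.index_eq_card_of_surjective
    (fun t => ⟨t * companion τ * t⁻¹, by
      obtain ⟨c1, c2, c3, c4⟩ := companion_apply τ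
      rw [trace_conj, c1, c4, zero_add]⟩) ?_ ?_
  · rintro ⟨s, hs⟩
    obtain ⟨t, ht⟩ := hconj s hs
    exact ⟨t, Subtype.ext ht⟩
  · intro s t
    rw [Subtype.mk.injEq, inv_mul_mem_centralizer_iff]

theorem index_extCentralizer_companion [Finite F] {τ : F} (hτ : ∀ x : F, x ^ 2 - τ * x + 1 ≠ 0)
    (hconj : ∀ s : SL(2, F), s 0 0 + s 1 1 = τ → ∃ t, t * companion τ * t⁻¹ = s) :
    (extCentralizer (companion τ)).index = Nat.card F * (Nat.card F - 1) / 2 := by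
  obtain ⟨c1, c2, c3, c4⟩ := companion_apply τ
  obtain ⟨d1, d2, d3, d4⟩ := companion_inv_apply τ
  have hne : (companion τ)⁻¹ ≠ companion τ := by
    intro h
    have h1 := congrArg (fun s : SL(2, F) => s 1 0) h
    have h2 := congrArg (fun s : SL(2, F) => s 0 0) h
    simp only [c1, c3, d1, d3] at h1 h2
    apply hτ 1
    linear_combination -h2 - h1
  obtain ⟨w, hw⟩ := hconj (companion τ)⁻¹ (by rw [d1, d4, add_zero])
  have hle : Subgroup.centralizer {companion τ} ≤ extCentralizer (companion τ) := by
    intro s hs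
    rw [Subgroup.mem_centralizer_singleton_iff] at hs
    left
    rw [hs, mul_inv_cancel_right]
  have hmem : ∀ s, s ∈ Subgroup.centralizer {companion τ} ↔
      s * companion τ * s⁻¹ = companion τ := by
    intro s
    rw [Subgroup.mem_centralizer_singleton_iff, mul_inv_eq_iff_eq_mul]
  have h2 : (Subgroup.centralizer {companion τ}).relIndex (extCentralizer (companion τ)) = 2 := by
    rw [Subgroup.relIndex_eq_two_iff]
    refine ⟨w, Or.inr hw, fun s hs => ?_⟩
    have e : s * w * companion τ * (s * w)⁻¹ = (s * companion τ * s⁻¹)⁻¹ := by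
      rw [mul_inv_rev, show s * w * companion τ * (w⁻¹ * s⁻¹) =
        s * (w * companion τ * w⁻¹) * s⁻¹ by group, hw, conj_inv]
    rw [hmem, hmem, e]
    rcases hs with hs | hs
    · rw [hs]
      exact Or.inr ⟨rfl, hne⟩
    · rw [hs, inv_inv]
      exact Or.inl ⟨rfl, hne⟩
  have h3 := Subgroup.relIndex_mul_index hle
  rw [h2, index_centralizer_companion hτ hconj] at h3
  omega

end Elliptic

/-! ### Involutions for `q ≡ 3 (mod 4)` -/

section ThreeModFour

variable {F : Type*} [Field F] [Finite F]

theorem not_isSquare_neg_one (hF : Nat.card F % 4 = 3) : ¬ IsSquare (-1 : F) := by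
  have := Fintype.ofFinite F
  rw [FiniteField.isSquare_neg_one_iff, ← Nat.card_eq_fintype_card]
  exact fun h => h hF

theorem isSquare_or_isSquare_neg (hF : Nat.card F % 4 = 3) (z : F) :
    IsSquare z ∨ IsSquare (-z) := by
  have hF' := not_isSquare_neg_one hF
  classical
  have := Fintype.ofFinite F
  by_contra! h
  rw [← quadraticChar_neg_one_iff_not_isSquare] at h hF'
  rw [← quadraticChar_neg_one_iff_not_isSquare, neg_eq_neg_one_mul z, map_mul, hF', h.1] at h
  exact absurd h.2 (by norm_num)

theorem no_root_zero (hF : Nat.card F % 4 = 3) (x : F) : x ^ 2 - 0 * x + 1 ≠ 0 := by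
  intro h
  exact not_isSquare_neg_one hF ⟨x, by linear_combination -h⟩

/-- If `q ≡ 3 (mod 4)`, the matrices of trace zero in `SL(2, q)` are conjugate: each of them is
conjugate to the companion matrix or to its negative, and these two are conjugate because `-1` is
a sum of two squares. -/
theorem exists_conj_companion_zero (hF : Nat.card F % 4 = 3) (s : SL(2, F))
    (hs : s 0 0 + s 1 1 = 0) : ∃ t, t * companion 0 * t⁻¹ = s := by
  have hs0 : s 1 0 ≠ 0 := lowerLeft_ne_zero (no_root_zero hF) hs
  rcases isSquare_or_isSquare_neg hF (s 1 0) with hsq | hsq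
  · exact exists_conj_companion_of_isSquare hs hs0 hsq
  · obtain ⟨t, ht⟩ := exists_conj_companion_of_isSquare (τ := 0) (s := -s)
      (by rw [sl_neg_apply, sl_neg_apply]; linear_combination -hs)
      (by rw [sl_neg_apply]; exact neg_ne_zero.2 hs0) (by rw [sl_neg_apply]; exact hsq)
    have : NeZero (ringChar F) := ⟨CharP.ringChar_ne_zero_of_finite F⟩
    obtain ⟨a, b, hab⟩ := CharP.sq_add_sq F (ringChar F) (-1)
    have hdet : (a : F) * (-a) - b * b = 1 := by
      push_cast at hab
      linear_combination -hab
    obtain ⟨r1, r2, r3, r4⟩ := slMk_apply (a : F) b b (-a) hdet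
    obtain ⟨c1, c2, c3, c4⟩ := companion_apply (0 : F)
    have hr : slMk (a : F) b b (-a) hdet * companion 0 =
        -(companion 0 * slMk (a : F) b b (-a) hdet) := by
      apply sl_ext <;> simp only [sl_mul_apply, sl_neg_apply, r1, r2, r3, r4, c1, c2, c3, c4] <;>
        ring
    refine ⟨t * slMk (a : F) b b (-a) hdet, ?_⟩
    rw [mul_inv_eq_iff_eq_mul] at ht ⊢
    rw [mul_assoc, hr, mul_neg, ← mul_assoc, ht]
    simp [mul_assoc]

/-- The class of involutions in `PSL(2, q)`, `q ≡ 3 (mod 4)`. -/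
theorem isNontrivialSubdegree_involutions {m : ℕ} [NeZero m] (hF : Nat.card F % 4 = 3)
    (α : Points m F) :
    IsNontrivialSubdegree (G m F) α ((Nat.card F * (Nat.card F - 1) / 2) ^ m) := by
  obtain ⟨c1, c2, c3, c4⟩ := companion_apply (0 : F)
  have hc : toPSL F (companion 0) ≠ 1 := by
    rw [Ne, toPSL_eq_one_iff]
    rintro (h | h) <;>
    · have := congrArg (fun s : SL(2, F) => s 1 0) h
      simp [sl_neg_apply, c3] at this
  have h1 : (Subgroup.centralizer {toPSL F (companion 0)}).comap (toPSL F) =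
      extCentralizer (companion 0) := by
    ext s
    rw [Subgroup.mem_comap, Subgroup.mem_centralizer_singleton_iff, ← map_mul, ← map_mul,
      toPSL_eq_iff, mem_extCentralizer, mul_inv_eq_iff_eq_mul, mul_inv_eq_iff_eq_mul,
      companion_zero_inv, neg_mul]
  have h2 := isNontrivialSubdegree_index_centralizer (m := m) hc α
  rwa [← Subgroup.index_comap_of_surjective _ toPSL_surjective, h1,
    index_extCentralizer_companion (no_root_zero hF) (exists_conj_companion_zero hF)] at h2

end ThreeModFour

/-! ### Nonsplit tori in characteristic two -/

section Even

variable {F : Type*} [Field F]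

/-- There are elliptic elements in `SL(2, q)`. -/
theorem exists_no_root [Finite F] [CharP F 2] : ∃ τ : F, ∀ x : F, x ^ 2 - τ * x + 1 ≠ 0 := by
  by_contra! h
  -- otherwise `x ↦ x + x⁻¹` maps the nonzero elements onto the field
  have hs : Function.Surjective fun u : Fˣ => (u : F) + (u : F)⁻¹ := by
    intro τ
    obtain ⟨x, hx⟩ := h τ
    have hx0 : x ≠ 0 := by
      rintro rfl
      simp at hx
    refine ⟨Units.mk0 x hx0, ?_⟩
    simp only [Units.val_mk0]
    field_simp
    linear_combination hx
  have h1 := Nat.card_le_card_of_surjective _ hs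
  have h2 := Nat.card_eq_card_units_add_one F
  omega

variable [CharP F 2]

theorem sl_neg_one_eq_one : (-1 : SL(2, F)) = 1 := by
  ext i j
  rw [sl_neg_apply, CharTwo.neg_eq]

theorem toPSL_eq_iff_of_charTwo {s t : SL(2, F)} : toPSL F s = toPSL F t ↔ s = t := by
  rw [toPSL_eq_iff, ← neg_one_mul t, sl_neg_one_eq_one, one_mul, or_self]

theorem trace_ne_zero_of_no_root {τ : F} (hτ : ∀ x : F, x ^ 2 - τ * x + 1 ≠ 0) : τ ≠ 0 := by
  rintro rfl
  apply hτ 1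
  linear_combination (CharTwo.two_eq_zero : (2 : F) = 0)

theorem exists_conj_companion_of_charTwo [Finite F] {τ : F} (hτ : ∀ x : F, x ^ 2 - τ * x + 1 ≠ 0)
    (s : SL(2, F)) (hs : s 0 0 + s 1 1 = τ) : ∃ t, t * companion τ * t⁻¹ = s := by
  have := Fintype.ofFinite F
  exact exists_conj_companion_of_isSquare hs (lowerLeft_ne_zero hτ hs)
    (FiniteField.isSquare_of_char_two (ringChar.eq F 2) _)

/-- The only conjugates of the companion matrix `c` in the centraliser of `c` are `c` and `c⁻¹`. -/
theorem eq_or_eq_inv_of_commute {τ : F} (hτ : τ ≠ 0) {d : SL(2, F)}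
    (hd : d 0 0 + d 1 1 = τ) (hcomm : d * companion τ = companion τ * d) :
    d = companion τ ∨ d = (companion τ)⁻¹ := by
  obtain ⟨c1, c2, c3, c4⟩ := companion_apply τ
  obtain ⟨i1, i2, i3, i4⟩ := companion_inv_apply τ
  obtain ⟨e1, e2⟩ := centralizer_companion_apply hcomm
  have two : (2 : F) = 0 := CharTwo.two_eq_zero
  have h10 : d 1 0 = 1 := by
    apply mul_left_cancel₀ hτ
    linear_combination hd - e2 - d 0 0 * two
  have hdet := sl_det d
  have h0 : d 0 0 * (d 0 0 + τ) = 0 := by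
    rw [e1, e2, h10] at hdet
    linear_combination hdet
  rw [h10] at e1 e2
  rcases mul_eq_zero.1 h0 with h | h
  · left
    apply sl_ext <;> simp only [c1, c2, c3, c4, h, h10, e1, e2]
    ring
  · right
    have h' : d 0 0 = τ := by linear_combination h - τ * two
    apply sl_ext <;> simp only [i1, i2, i3, i4, h', h10, e1, e2]
    · linear_combination -two
    · linear_combination two
    · linear_combination τ * two

theorem eq_one_of_centralizer {τ : F} {x : SL(2, F)}
    (hx : x * companion τ = companion τ * x) (h10 : x 1 0 = 0) : x = 1 := by
  obtain ⟨e1, e2⟩ := centralizer_companion_apply hx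
  rw [h10] at e1 e2
  have hdet := sl_det x
  rw [h10, e1, e2] at hdet
  have two : (2 : F) = 0 := CharTwo.two_eq_zero
  have h0 : x 0 0 = 1 := by
    have : (x 0 0 - 1) ^ 2 = 0 := by linear_combination hdet - (x 0 0 - 1) * two
    linear_combination pow_eq_zero_iff two_ne_zero |>.1 this
  obtain ⟨o1, o2, o3, o4⟩ := sl_one_apply (F := F)
  apply sl_ext <;> simp only [o1, o2, o3, o4, h10, e1, e2, h0]
  · ring
  · ring

/-- A nontrivial element of the torus that centralises or inverts `d` commutes with it, so that `d`
lies in the torus. -/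
theorem commute_companion_of_mem_extCentralizer {τ : F} (hτ : τ ≠ 0) {x d : SL(2, F)}
    (hx : x * companion τ = companion τ * x) (hx1 : x ≠ 1) (hd : x ∈ extCentralizer d) :
    d * companion τ = companion τ * d := by
  have h10 : x 1 0 ≠ 0 := fun h => hx1 (eq_one_of_centralizer hx h)
  rcases hd with hd | hd
  · exact commute_companion_of_commute hx h10 (mul_inv_eq_iff_eq_mul.1 hd)
  · obtain ⟨e1, e2⟩ := centralizer_companion_apply hx
    have two : (2 : F) = 0 := CharTwo.two_eq_zero
    refine commute_companion_of_commute (x := x * x) ?_ ?_ ?_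
    · rw [mul_assoc, hx, ← mul_assoc, hx, mul_assoc]
    · rw [sl_mul_apply, e2]
      have : x 1 0 * x 0 0 + (x 0 0 + τ * x 1 0) * x 1 0 = τ * x 1 0 ^ 2 := by
        linear_combination x 0 0 * x 1 0 * two
      rw [this]
      exact mul_ne_zero hτ (pow_ne_zero 2 h10)
    · have h1 : x * d⁻¹ * x⁻¹ = d := by rw [← conj_inv, hd, inv_inv]
      rw [mul_inv_eq_iff_eq_mul] at hd h1
      rw [mul_assoc, hd, ← mul_assoc, h1, mul_assoc]

theorem mem_extCentralizer_of_commute {τ : F} (hτ : τ ≠ 0) {t : SL(2, F)}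
    (h : t * companion τ * t⁻¹ * companion τ = companion τ * (t * companion τ * t⁻¹)) :
    t ∈ extCentralizer (companion τ) := by
  obtain ⟨c1, c2, c3, c4⟩ := companion_apply τ
  exact eq_or_eq_inv_of_commute hτ (by rw [trace_conj, c1, c4, zero_add]) h

/-- The dihedral group `extCentralizer (companion τ)` is contained in no other conjugate of itself. -/
theorem mem_extCentralizer_companion_of_conj_mem {τ : F} (hτ : τ ≠ 0) (t : SL(2, F))
    (ht : ∀ a ∈ extCentralizer (companion τ), t⁻¹ * a * t ∈ extCentralizer (companion τ)) :
    t ∈ extCentralizer (companion τ) := by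
  have h := ht (companion τ) (Or.inl (by group))
  rw [conj_mem_extCentralizer_iff] at h
  refine mem_extCentralizer_of_commute hτ
    (commute_companion_of_mem_extCentralizer hτ rfl (fun h1 => ?_) h)
  have := congrArg (fun s : SL(2, F) => s 1 0) h1
  simp [(companion_apply τ).2.2.1] at this

/-- The intersection of the dihedral group `extCentralizer (companion τ)` with another conjugate
has order at most two. -/
theorem eq_one_or_mul_eq_one_of_inter {τ : F} (hτ : τ ≠ 0) {t₀ : SL(2, F)}
    (ht₀ : t₀ ∉ extCentralizer (companion τ)) {u v : SL(2, F)}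
    (hu : u ∈ extCentralizer (companion τ)) (hu' : t₀⁻¹ * u * t₀ ∈ extCentralizer (companion τ))
    (hv : v ∈ extCentralizer (companion τ)) (hv' : t₀⁻¹ * v * t₀ ∈ extCentralizer (companion τ)) :
    u = 1 ∨ v = 1 ∨ u * v = 1 := by
  have key : ∀ x, x * companion τ = companion τ * x →
      t₀⁻¹ * x * t₀ ∈ extCentralizer (companion τ) → x = 1 := by
    intro x hx hx'
    by_contra hx1
    rw [conj_mem_extCentralizer_iff] at hx'
    exact ht₀ (mem_extCentralizer_of_commute hτ
      (commute_companion_of_mem_extCentralizer hτ hx hx1 hx'))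
  rcases hu with hu | hu
  · exact Or.inl (key u (mul_inv_eq_iff_eq_mul.1 hu) hu')
  rcases hv with hv | hv
  · exact Or.inr (Or.inl (key v (mul_inv_eq_iff_eq_mul.1 hv) hv'))
  refine Or.inr (Or.inr (key _ ?_ ?_))
  · rw [← mul_inv_eq_iff_eq_mul, mul_inv_rev,
      show u * v * companion τ * (v⁻¹ * u⁻¹) = u * (v * companion τ * v⁻¹) * u⁻¹ by group, hv,
      ← conj_inv, hu, inv_inv]
  · have := mul_mem hu' hv'
    rwa [show t₀⁻¹ * u * t₀ * (t₀⁻¹ * v * t₀) = t₀⁻¹ * (u * v) * t₀ by group] at this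

variable {m : ℕ} [NeZero m] [Finite F]

/-- The class of an element of a nonsplit torus, which is its own centraliser. -/
theorem isNontrivialSubdegree_torus_of_charTwo (α : Points m F) :
    IsNontrivialSubdegree (G m F) α ((Nat.card F * (Nat.card F - 1)) ^ m) := by
  obtain ⟨τ, hτ⟩ := exists_no_root (F := F)
  have hc : toPSL F (companion τ) ≠ 1 := by
    rw [← map_one (toPSL F), Ne, toPSL_eq_iff_of_charTwo]
    intro h
    have := congrArg (fun s : SL(2, F) => s 1 0) h
    simp [(companion_apply τ).2.2.1] at this
  have h1 : (Subgroup.centralizer {toPSL F (companion τ)}).comap (toPSL F) =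
      Subgroup.centralizer {companion τ} := by
    ext s
    rw [Subgroup.mem_comap, Subgroup.mem_centralizer_singleton_iff,
      Subgroup.mem_centralizer_singleton_iff, ← map_mul, ← map_mul, toPSL_eq_iff_of_charTwo]
  have h2 := isNontrivialSubdegree_index_centralizer (m := m) hc α
  rwa [← Subgroup.index_comap_of_surjective _ toPSL_surjective, h1,
    index_centralizer_companion hτ (exists_conj_companion_of_charTwo hτ)] at h2

/-- The normaliser of a nonsplit torus, a dihedral group of order `2 (q + 1)`; two of its conjugates
intersect in a group of order at most two, which is centralised by its own elements. -/
theorem isNontrivialSubdegree_dihedral_of_charTwo (hm : 3 ≤ m) (hF : 4 ≤ Nat.card F)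
    (α : Points m F) :
    IsNontrivialSubdegree (G m F) α ((Nat.card F * (Nat.card F - 1) / 2) ^ m) := by
  obtain ⟨τ, hτ⟩ := exists_no_root (F := F)
  have hτ0 := trace_ne_zero_of_no_root hτ
  have hidx := index_extCentralizer_companion hτ (exists_conj_companion_of_charTwo hτ)
  obtain ⟨t₀, ht₀⟩ : ∃ t₀, t₀ ∉ extCentralizer (companion τ) := by
    by_contra! h
    rw [(Subgroup.eq_top_iff' _).2 h, Subgroup.index_top] at hidx
    have : 4 * 3 ≤ Nat.card F * (Nat.card F - 1) := Nat.mul_le_mul hF (by omega)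
    omega
  -- any nontrivial element will do if the intersection of the two conjugates is trivial
  obtain ⟨c, hc1, hc⟩ : ∃ c : SL(2, F), c ≠ 1 ∧ ∀ u ∈ extCentralizer (companion τ),
      t₀⁻¹ * u * t₀ ∈ extCentralizer (companion τ) → u * c = c * u := by
    by_cases h : ∃ c ∈ extCentralizer (companion τ),
        t₀⁻¹ * c * t₀ ∈ extCentralizer (companion τ) ∧ c ≠ 1
    · obtain ⟨c, h1, h2, h3⟩ := h
      refine ⟨c, h3, fun u hu hu' => ?_⟩
      rcases eq_one_or_mul_eq_one_of_inter hτ0 ht₀ hu hu' h1 h2 with rfl | h4 | h4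
      · rw [one_mul, mul_one]
      · exact absurd h4 h3
      · rw [eq_inv_of_mul_eq_one_left h4, inv_mul_cancel, mul_inv_cancel]
    · push Not at h
      refine ⟨t₀, fun h1 => ht₀ (h1 ▸ one_mem _), fun u hu hu' => ?_⟩
      rw [h u hu hu', one_mul, mul_one]
  rw [← hidx]
  refine isNontrivialSubdegree_index_of_three_le_of_surjective hm toPSL_surjective ?_ ht₀
    (c := c) ?_
    (fun u hu hu' => by rw [hc u hu hu']) (mem_extCentralizer_companion_of_conj_mem hτ0) α
  · rw [ker_toPSL_le_iff, sl_neg_one_eq_one]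
    exact one_mem _
  · rwa [← map_one (toPSL F), Ne, toPSL_eq_iff_of_charTwo]

end Even

/-! ### Unipotent elements -/

section Unipotent

variable {F : Type*} [Field F]

/-- The group of upper unitriangular matrices. -/
def unipotent (F : Type*) [Field F] : Subgroup SL(2, F) where
  carrier := {s | s 0 0 = 1 ∧ s 1 0 = 0}
  one_mem' := by simp
  mul_mem' := by
    rintro s t ⟨hs, hs'⟩ ⟨ht, ht'⟩
    constructor
    · rw [sl_mul_apply, hs, ht, ht']
      ring
    · rw [sl_mul_apply, hs', ht']
      ring
  inv_mem' := by
    rintro s ⟨hs, hs'⟩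
    obtain ⟨i1, i2, i3, i4⟩ := sl_inv_apply s
    have := sl_det s
    rw [hs, hs'] at this
    constructor
    · rw [i1]
      linear_combination this
    · rw [i3, hs', neg_zero]

theorem mem_unipotent {s : SL(2, F)} : s ∈ unipotent F ↔ s 0 0 = 1 ∧ s 1 0 = 0 := Iff.rfl

theorem index_unipotent [Finite F] : (unipotent F).index = Nat.card F ^ 2 - 1 := by
  classical
  have := Fintype.ofFinite F
  have hcard : Nat.card {v : F × F // v ≠ 0} = Nat.card F ^ 2 - 1 := by
    rw [Nat.card_eq_fintype_card, Fintype.card_subtype_compl, Fintype.card_prod,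
      Fintype.card_subtype_eq, Nat.card_eq_fintype_card, sq]
  rw [← hcard]
  refine Subgroup.index_eq_card_of_surjective (fun s => ⟨(s 0 0, s 1 0), fun h => ?_⟩) ?_ ?_
  · rw [Prod.mk_eq_zero] at h
    have := sl_det s
    rw [h.1, h.2] at this
    simp at this
  · rintro ⟨⟨x, z⟩, hv⟩
    by_cases hx : x = 0
    · have hz : z ≠ 0 := by
        rintro rfl
        exact hv (by rw [hx]; rfl)
      refine ⟨slMk x (-z⁻¹) z 0 ?_, rfl⟩
      rw [neg_mul, inv_mul_cancel₀ hz]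
      ring
    · refine ⟨slMk x 0 z x⁻¹ ?_, rfl⟩
      rw [mul_inv_cancel₀ hx]
      ring
  · intro s t
    obtain ⟨i1, i2, i3, i4⟩ := sl_inv_apply s
    have hs := sl_det s
    rw [Subtype.mk.injEq, Prod.mk.injEq, mem_unipotent, sl_mul_apply, sl_mul_apply, i1, i2, i3, i4]
    constructor
    · rintro ⟨h1, h2⟩
      rw [← h1, ← h2]
      exact ⟨by linear_combination hs, by ring⟩
    · rintro ⟨h1, h2⟩
      constructor
      · linear_combination t 0 0 * hs - s 0 0 * h1 - s 0 1 * h2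
      · linear_combination t 1 0 * hs - s 1 0 * h1 - s 1 1 * h2

/-- `|SL(2, q)| = q (q ^ 2 - 1)`. -/
theorem card_sl [Finite F] : Nat.card SL(2, F) = Nat.card F * (Nat.card F ^ 2 - 1) := by
  rw [← index_unipotent, ← Subgroup.card_mul_index (unipotent F)]
  congr 1
  refine Nat.card_congr (Equiv.ofBijective (fun s : unipotent F => s.1 0 1) ⟨?_, ?_⟩)
  · rintro ⟨s, hs, hs'⟩ ⟨t, ht, ht'⟩ h
    simp only at h
    have h1 := sl_det s
    have h2 := sl_det t
    rw [hs, hs'] at h1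
    rw [ht, ht'] at h2
    exact Subtype.ext (sl_ext (hs.trans ht.symm) h (hs'.trans ht'.symm)
      (by linear_combination h1 - h2))
  · intro b
    exact ⟨⟨slMk 1 b 0 1 (by ring), rfl, rfl⟩, rfl⟩

/-- For odd `q`, the class of a unipotent element of `PSL(2, q)` has size `(q ^ 2 - 1) / 2`. -/
theorem isNontrivialSubdegree_unipotent [Finite F] (h2 : (2 : F) ≠ 0) {m : ℕ} [NeZero m]
    (α : Points m F) : IsNontrivialSubdegree (G m F) α (((Nat.card F ^ 2 - 1) / 2) ^ m) := by
  have hdet : (1 : F) * 1 - 1 * 0 = 1 := by ring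
  obtain ⟨c1, c2, c3, c4⟩ := slMk_apply (1 : F) 1 0 1 hdet
  have hc : toPSL F (slMk 1 1 0 1 hdet) ≠ 1 := by
    rw [Ne, toPSL_eq_one_iff]
    rintro (h | h) <;>
    · have := congrArg (fun s : SL(2, F) => s 0 1) h
      simp [sl_neg_apply, c2] at this
  have hsub := isNontrivialSubdegree_index_centralizer (m := m) hc α
  set C := (Subgroup.centralizer {toPSL F (slMk 1 1 0 1 hdet)}).comap (toPSL F) with hC
  have hmem : ∀ s, s ∈ C ↔ s 1 0 = 0 ∧ (s 0 0 = 1 ∨ s 0 0 = -1) := by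
    intro s
    have hd := sl_det s
    rw [hC, Subgroup.mem_comap, Subgroup.mem_centralizer_singleton_iff, ← map_mul, ← map_mul,
      toPSL_eq_iff]
    constructor
    · rintro (h | h)
      · have e1 := congrArg (fun s : SL(2, F) => s 0 0) h
        have e2 := congrArg (fun s : SL(2, F) => s 0 1) h
        simp only [sl_mul_apply, c1, c2, c3, c4] at e1 e2
        have h10 : s 1 0 = 0 := by linear_combination -e1
        refine ⟨h10, mul_self_eq_one_iff.1 ?_⟩
        linear_combination hd + s 0 1 * h10 + s 0 0 * e2
      · have e1 := congrArg (fun s : SL(2, F) => s 1 0) h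
        have e2 := congrArg (fun s : SL(2, F) => s 0 0) h
        simp only [sl_mul_apply, sl_neg_apply, c1, c2, c3, c4] at e1 e2
        have h10 : s 1 0 = 0 := by
          apply mul_left_cancel₀ h2
          linear_combination e1
        have h00 : s 0 0 = 0 := by
          apply mul_left_cancel₀ h2
          linear_combination e2 - h10
        rw [h10, h00] at hd
        simp at hd
    · rintro ⟨h10, h00⟩
      left
      have h11 : s 1 1 = s 0 0 := by
        rw [h10] at hd
        rcases h00 with h00 | h00 <;> rw [h00] at hd ⊢
        · linear_combination hd
        · linear_combination -hd
      apply sl_ext <;> simp only [sl_mul_apply, c1, c2, c3, c4, h10, h11] <;> ring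
  have hle : unipotent F ≤ C := by
    rintro s ⟨hs, hs'⟩
    exact (hmem s).2 ⟨hs', Or.inl hs⟩
  have hne : (1 : F) ≠ -1 := by
    intro h
    apply h2
    linear_combination h
  have hrel : (unipotent F).relIndex C = 2 := by
    rw [Subgroup.relIndex_eq_two_iff]
    refine ⟨-1, (hmem _).2 ?_, fun s hs => ?_⟩
    · rw [sl_neg_apply, sl_neg_apply]
      simp
    · rw [mul_neg_one, mem_unipotent, mem_unipotent, sl_neg_apply, sl_neg_apply]
      rcases (hmem s).1 hs with ⟨h1, h0 | h0⟩
      · refine Or.inr ⟨⟨h0, h1⟩, fun h => hne ?_⟩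
        linear_combination -h.1 - h0
      · refine Or.inl ⟨⟨by rw [h0, neg_neg], by rw [h1, neg_zero]⟩, fun h => hne ?_⟩
        linear_combination h0 - h.1
  have h3 := Subgroup.relIndex_mul_index hle
  rw [hrel, index_unipotent] at h3
  rw [← Subgroup.index_comap_of_surjective _ toPSL_surjective, ← hC] at hsub
  rwa [← h3, Nat.mul_div_cancel_left _ two_pos]

end Unipotent

/-! ### Subgroups given by explicit matrices -/

section Numerical

/-- A matrix over the prime field, given by natural numbers that represent its entries, row by
row. -/
abbrev Quad := ℕ × ℕ × ℕ × ℕ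

/-- The product of matrices modulo `p`. -/
def quadMul (p : ℕ) (x y : Quad) : Quad :=
  ((x.1 * y.1 + x.2.1 * y.2.2.1) % p, (x.1 * y.2.1 + x.2.1 * y.2.2.2) % p,
    (x.2.2.1 * y.1 + x.2.2.2 * y.2.2.1) % p, (x.2.2.1 * y.2.1 + x.2.2.2 * y.2.2.2) % p)

/-- The negative of a matrix modulo `p`. -/
def quadNeg (p : ℕ) (x : Quad) : Quad :=
  ((p - 1) * x.1 % p, (p - 1) * x.2.1 % p, (p - 1) * x.2.2.1 % p, (p - 1) * x.2.2.2 % p)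

/-- The inverse of a matrix of determinant one modulo `p`. -/
def quadInv (p : ℕ) (x : Quad) : Quad :=
  (x.2.2.2, (p - 1) * x.2.1 % p, (p - 1) * x.2.2.1 % p, x.1)

/-- The first `n` powers of a matrix. -/
def quadPowers (p : ℕ) (x : Quad) : ℕ → List Quad
  | 0 => []
  | n + 1 => (1, 0, 0, 1) :: (quadPowers p x n).map (quadMul p x)

/-- All products of a matrix in the first list with one in the second. -/
def quadProducts (p : ℕ) (X Y : List Quad) : List Quad :=
  X.flatMap fun x => Y.map (quadMul p x)

/-- The products `i ^ a * j ^ b * w ^ k * z ^ l` with `a < 4`, `b < 2`, `k < 3`, `l < n`. If `i`, `j`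
generate a quaternion group that is normalised by `w` of order three, then these are `8 * 3 * n`
elements: a binary octahedral group for `n = 2` and a binary icosahedral group for `n = 5`, for
suitable `z`. -/
def quadGroup (p : ℕ) (i j w z : Quad) (n : ℕ) : List Quad :=
  quadProducts p (quadProducts p (quadProducts p (quadPowers p i 4) (quadPowers p j 2))
    (quadPowers p w 3)) (quadPowers p z n)

/-- All entries are less than `p`. -/
def IsReduced (p : ℕ) (x : Quad) : Prop :=
  x.1 < p ∧ x.2.1 < p ∧ x.2.2.1 < p ∧ x.2.2.2 < p

/-- All entries are less than `p`, and the determinant is one modulo `p`. -/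
def IsReducedSL (p : ℕ) (x : Quad) : Prop :=
  IsReduced p x ∧ x.1 * x.2.2.2 % p = (x.2.1 * x.2.2.1 + 1) % p

instance (p : ℕ) : DecidablePred (IsReducedSL p) := fun x => by
  unfold IsReducedSL IsReduced
  infer_instance

theorem isReduced_quadMul {p : ℕ} (hp : 0 < p) (x y : Quad) : IsReduced p (quadMul p x y) :=
  ⟨Nat.mod_lt _ hp, Nat.mod_lt _ hp, Nat.mod_lt _ hp, Nat.mod_lt _ hp⟩

variable {F : Type*} [Field F]

/-- The entries of `s` are those given by `x`. -/
def Represents (x : Quad) (s : SL(2, F)) : Prop :=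
  s 0 0 = (x.1 : F) ∧ s 0 1 = (x.2.1 : F) ∧ s 1 0 = (x.2.2.1 : F) ∧ s 1 1 = (x.2.2.2 : F)

theorem Represents.eq {x : Quad} {s t : SL(2, F)} (hs : Represents x s) (ht : Represents x t) :
    s = t := by
  obtain ⟨h1, h2, h3, h4⟩ := hs
  obtain ⟨k1, k2, k3, k4⟩ := ht
  exact sl_ext (h1.trans k1.symm) (h2.trans k2.symm) (h3.trans k3.symm) (h4.trans k4.symm)

theorem represents_one : Represents (1, 0, 0, 1) (1 : SL(2, F)) := by
  obtain ⟨h1, h2, h3, h4⟩ := sl_one_apply (F := F)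
  exact ⟨by rw [h1, Nat.cast_one], by rw [h2, Nat.cast_zero], by rw [h3, Nat.cast_zero],
    by rw [h4, Nat.cast_one]⟩

section CharP

variable {p : ℕ} [CharP F p]

theorem natCast_mod_eq (k : ℕ) : ((k % p : ℕ) : F) = k := (CharP.cast_eq_mod F p k).symm

theorem Represents.mul {x y : Quad} {s t : SL(2, F)} (hs : Represents x s) (ht : Represents y t) :
    Represents (quadMul p x y) (s * t) := by
  obtain ⟨h1, h2, h3, h4⟩ := hs
  obtain ⟨k1, k2, k3, k4⟩ := ht
  refine ⟨?_, ?_, ?_, ?_⟩ <;>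
  · rw [sl_mul_apply]
    simp only [quadMul, natCast_mod_eq, h1, h2, h3, h4, k1, k2, k3, k4]
    push_cast
    ring

theorem natCast_pred_mul (hp : 0 < p) (k : ℕ) : (((p - 1) * k % p : ℕ) : F) = -k := by
  rw [natCast_mod_eq, Nat.cast_mul, Nat.cast_sub hp, CharP.cast_eq_zero, Nat.cast_one]
  ring

theorem Represents.neg (hp : 0 < p) {x : Quad} {s : SL(2, F)} (hs : Represents x s) :
    Represents (quadNeg p x) (-s) := by
  obtain ⟨h1, h2, h3, h4⟩ := hs
  refine ⟨?_, ?_, ?_, ?_⟩ <;>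
  · rw [sl_neg_apply]
    simp only [quadNeg, natCast_pred_mul hp, h1, h2, h3, h4]

theorem Represents.inv (hp : 0 < p) {x : Quad} {s : SL(2, F)} (hs : Represents x s) :
    Represents (quadInv p x) s⁻¹ := by
  obtain ⟨h1, h2, h3, h4⟩ := hs
  obtain ⟨i1, i2, i3, i4⟩ := sl_inv_apply s
  refine ⟨?_, ?_, ?_, ?_⟩
  · rw [i1, h4]; rfl
  · rw [i2, h2]; simp only [quadInv, natCast_pred_mul hp]
  · rw [i3, h3]; simp only [quadInv, natCast_pred_mul hp]
  · rw [i4, h1]; rfl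

theorem IsReducedSL.exists_represents {x : Quad} (hx : IsReducedSL p x) :
    ∃ s : SL(2, F), Represents x s := by
  have h := congrArg (fun k : ℕ => (k : F)) hx.2
  simp only [natCast_mod_eq] at h
  push_cast at h
  exact ⟨slMk x.1 x.2.1 x.2.2.1 x.2.2.2 (by linear_combination h), rfl, rfl, rfl, rfl⟩

theorem IsReduced.eq {x y : Quad} (hx : IsReduced p x) (hy : IsReduced p y) {s : SL(2, F)}
    (hs : Represents x s) (hs' : Represents y s) : x = y := by
  have key : ∀ a b : ℕ, a < p → b < p → (a : F) = b → a = b := by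
    intro a b ha hb h
    rw [CharP.natCast_eq_natCast F p] at h
    exact h.eq_of_lt_of_lt ha hb
  obtain ⟨x1, x2, x3, x4⟩ := hx
  obtain ⟨y1, y2, y3, y4⟩ := hy
  obtain ⟨h1, h2, h3, h4⟩ := hs
  obtain ⟨k1, k2, k3, k4⟩ := hs'
  ext
  · exact key _ _ x1 y1 (h1.symm.trans k1)
  · exact key _ _ x2 y2 (h2.symm.trans k2)
  · exact key _ _ x3 y3 (h3.symm.trans k3)
  · exact key _ _ x4 y4 (h4.symm.trans k4)

theorem exists_represents_mem_of_powers {A : Subgroup SL(2, F)} {x : Quad} {s : SL(2, F)}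
    (hs : s ∈ A) (hx : Represents x s) (n : ℕ) :
    ∀ y ∈ quadPowers p x n, ∃ t ∈ A, Represents y t := by
  induction n with
  | zero => simp [quadPowers]
  | succ n ih =>
    intro y hy
    rw [quadPowers, List.mem_cons, List.mem_map] at hy
    rcases hy with rfl | ⟨z, hz, rfl⟩
    · exact ⟨1, A.one_mem, represents_one⟩
    · obtain ⟨t, ht, hzt⟩ := ih z hz
      exact ⟨s * t, A.mul_mem hs ht, hx.mul hzt⟩

theorem exists_represents_mem_of_products {A : Subgroup SL(2, F)} {X Y : List Quad}
    (hX : ∀ x ∈ X, ∃ s ∈ A, Represents x s) (hY : ∀ x ∈ Y, ∃ s ∈ A, Represents x s) :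
    ∀ x ∈ quadProducts p X Y, ∃ s ∈ A, Represents x s := by
  intro x hx
  rw [quadProducts, List.mem_flatMap] at hx
  obtain ⟨y, hy, hx⟩ := hx
  rw [List.mem_map] at hx
  obtain ⟨z, hz, rfl⟩ := hx
  obtain ⟨s, hs, hys⟩ := hX y hy
  obtain ⟨t, ht, hzt⟩ := hY z hz
  exact ⟨s * t, A.mul_mem hs ht, hys.mul hzt⟩

/-- If the list `quadGroup p i j w z n` is closed under right multiplication by `i`, `j`, `w`, `z`,
then it represents the elements of a subgroup. -/
theorem exists_subgroup_of_quadGroup [Finite F] {i j w z : Quad} {n : ℕ}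
    (hg : ∀ g ∈ [i, j, w, z], IsReducedSL p g)
    (h1 : (1, 0, 0, 1) ∈ quadGroup p i j w z n)
    (hmul : ∀ x ∈ quadGroup p i j w z n, ∀ g ∈ [i, j, w, z],
      quadMul p x g ∈ quadGroup p i j w z n) :
    ∃ A : Subgroup SL(2, F), ∀ s, s ∈ A ↔ ∃ x ∈ quadGroup p i j w z n, Represents x s := by
  obtain ⟨si, hi⟩ := (hg i (by simp)).exists_represents (F := F)
  obtain ⟨sj, hj⟩ := (hg j (by simp)).exists_represents (F := F)
  obtain ⟨sw, hw⟩ := (hg w (by simp)).exists_represents (F := F)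
  obtain ⟨sz, hz⟩ := (hg z (by simp)).exists_represents (F := F)
  let A : Subgroup SL(2, F) := Subgroup.closure {si, sj, sw, sz}
  have hsub : {si, sj, sw, sz} ⊆ (A : Set SL(2, F)) := Subgroup.subset_closure
  refine ⟨A, fun s => ⟨fun hs => ?_, ?_⟩⟩
  · have hs' : s ∈ Submonoid.closure {si, sj, sw, sz} := by
      rw [← Subgroup.closure_toSubmonoid_of_finite]
      exact hs
    refine Submonoid.closure_induction_right
      (motive := fun s _ => ∃ x ∈ quadGroup p i j w z n, Represents x s)
      ⟨_, h1, represents_one⟩ ?_ hs'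
    rintro s - t ht ⟨x, hx, hxs⟩
    simp only [Set.mem_insert_iff, Set.mem_singleton_iff] at ht
    rcases ht with rfl | rfl | rfl | rfl
    · exact ⟨_, hmul x hx i (by simp), hxs.mul hi⟩
    · exact ⟨_, hmul x hx j (by simp), hxs.mul hj⟩
    · exact ⟨_, hmul x hx w (by simp), hxs.mul hw⟩
    · exact ⟨_, hmul x hx z (by simp), hxs.mul hz⟩
  · rintro ⟨x, hx, hxs⟩
    obtain ⟨t, ht, hxt⟩ := exists_represents_mem_of_products
      (exists_represents_mem_of_products (exists_represents_mem_of_products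
        (exists_represents_mem_of_powers (A := A) (hsub (by simp)) hi 4)
        (exists_represents_mem_of_powers (hsub (by simp)) hj 2))
        (exists_represents_mem_of_powers (hsub (by simp)) hw 3))
        (exists_represents_mem_of_powers (hsub (by simp)) hz n) x hx
    rwa [hxs.eq hxt]

/-- The order of a subgroup that is represented by a list of reduced matrices. -/
theorem card_eq_length {A : Subgroup SL(2, F)} {L : List Quad}
    (hA : ∀ s, s ∈ A ↔ ∃ x ∈ L, Represents x s) (hL : L.Nodup) (hred : ∀ x ∈ L, IsReducedSL p x) :
    Nat.card A = L.length := by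
  rw [← List.toFinset_card_of_nodup hL, ← Fintype.card_coe, ← Nat.card_eq_fintype_card]
  choose f hf using fun s : A => (hA s.1).1 s.2
  refine Nat.card_congr (Equiv.ofBijective
    (fun s => (⟨f s, List.mem_toFinset.2 (hf s).1⟩ : L.toFinset)) ⟨fun s t h => ?_, ?_⟩)
  · have h' : f s = f t := congrArg Subtype.val h
    have h1 := (hf s).2
    rw [h'] at h1
    exact Subtype.ext (h1.eq (hf t).2)
  · rintro ⟨x, hx⟩
    rw [List.mem_toFinset] at hx
    obtain ⟨s, hs⟩ := (hred x hx).exists_represents (F := F)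
    exact ⟨⟨s, (hA s).2 ⟨x, hx, hs⟩⟩,
      Subtype.ext ((hred _ (hf _).1).1.eq (hred x hx).1 (hf ⟨s, _⟩).2 hs)⟩

/-- The hypotheses of `isNontrivialSubdegree_index_of_isCoatom` in terms of lists of matrices. -/
theorem isNontrivialSubdegree_index_of_list {m : ℕ} [NeZero m] (hm : 2 ≤ m) (hp : 0 < p)
    {A : Subgroup SL(2, F)} {L : List Quad} (hA : ∀ s, s ∈ A ↔ ∃ x ∈ L, Represents x s)
    (hcoatom : IsCoatom A) (hred : ∀ x ∈ L, IsReducedSL p x) (hneg : quadNeg p (1, 0, 0, 1) ∈ L)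
    {t c : Quad} (ht : IsReducedSL p t) (hc : IsReducedSL p c) (hc0 : c.2.1 ≠ 0)
    (hn : ∃ x ∈ L, quadMul p (quadMul p (quadInv p t) x) t ∉ L)
    (hfix : ∀ x ∈ L, quadMul p (quadMul p (quadInv p t) x) t ∈ L →
      quadMul p x c = quadMul p c x ∨ quadMul p x c = quadNeg p (quadMul p c x))
    (hswap : ∀ x ∈ L, quadMul p (quadMul p t x) t ∈ L →
      quadMul p (quadMul p t x) c = quadMul p c (quadMul p t x) ∨
        quadMul p (quadMul p t x) c = quadNeg p (quadMul p c (quadMul p t x)))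
    (α : Points m F) : IsNontrivialSubdegree (G m F) α (A.index ^ m) := by
  obtain ⟨t₀, ht₀⟩ := ht.exists_represents (F := F)
  obtain ⟨c₀, hc₀⟩ := hc.exists_represents (F := F)
  have hmem : ∀ {y : Quad} {s : SL(2, F)}, IsReduced p y → Represents y s → s ∈ A → y ∈ L := by
    intro y s hy hs hsA
    obtain ⟨x, hx, hxs⟩ := (hA s).1 hsA
    rwa [hy.eq (hred x hx).1 hs hxs]
  have hcomm : ∀ {x : Quad} {u : SL(2, F)}, Represents x u →
      (quadMul p x c = quadMul p c x ∨ quadMul p x c = quadNeg p (quadMul p c x)) →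
      toPSL F (u * c₀) = toPSL F (c₀ * u) := by
    intro x u hu h
    rw [toPSL_eq_iff]
    rcases h with h | h
    · left
      have h1 := hu.mul (p := p) hc₀
      rw [h] at h1
      exact h1.eq (hc₀.mul hu)
    · right
      have h1 := hu.mul (p := p) hc₀
      rw [h] at h1
      exact h1.eq ((hc₀.mul hu).neg hp)
  refine isNontrivialSubdegree_index_of_isCoatom_of_surjective hm toPSL_surjective
    ?_ hcoatom (t₀ := t₀) (c := c₀) ?_ ?_ ?_ ?_ α
  · rw [ker_toPSL_le_iff, hA]
    exact ⟨_, hneg, represents_one.neg hp⟩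
  · obtain ⟨x, hx, hxt⟩ := hn
    obtain ⟨s, hs⟩ := (hred x hx).exists_represents (F := F)
    exact ⟨s, (hA s).2 ⟨x, hx, hs⟩, fun h => hxt (hmem (isReduced_quadMul hp _ _)
      (((ht₀.inv hp).mul hs).mul ht₀) h)⟩
  · rw [Ne, toPSL_eq_one_iff]
    have h01 : c₀ 0 1 ≠ 0 := by
      rw [hc₀.2.1, Ne, CharP.cast_eq_zero_iff F p]
      exact fun h => hc0 (Nat.eq_zero_of_dvd_of_lt h hc.1.2.1)
    rintro (h | h) <;>
    · rw [h] at h01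
      simp [sl_neg_apply] at h01
  · intro u hu hu'
    obtain ⟨x, hx, hxu⟩ := (hA u).1 hu
    exact hcomm hxu (hfix x hx (hmem (isReduced_quadMul hp _ _)
      (((ht₀.inv hp).mul hxu).mul ht₀) hu'))
  · intro u hu hu'
    obtain ⟨x, hx, hxu⟩ := (hA _).1 hu
    have h1 := ht₀.mul (p := p) hxu
    rw [mul_inv_cancel_left] at h1
    exact hcomm h1 (hswap x hx (hmem (isReduced_quadMul hp _ _) (h1.mul ht₀) hu'))

end CharP

theorem _root_.Subgroup.isCoatom_of_prime_index {G : Type*} [Group G] {A : Subgroup G}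
    (h : A.index.Prime) : IsCoatom A := by
  refine ⟨fun h1 => ?_, fun B hB => ?_⟩
  · rw [h1, Subgroup.index_top] at h
    exact Nat.not_prime_one h
  · have h1 := Subgroup.relIndex_mul_index hB.le
    have h2 : A.relIndex B ≠ 1 := fun h2 => hB.not_ge (Subgroup.relIndex_eq_one.1 h2)
    rw [← Subgroup.index_eq_one]
    rcases h.eq_one_or_self_of_dvd _ (Subgroup.index_dvd_of_le hB.le) with h3 | h3
    · exact h3
    · rw [h3] at h1
      exact absurd (Nat.eq_of_mul_eq_mul_right h.pos (h1.trans (one_mul _).symm)) h2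

end Numerical

/-! ### The subgroups of index 7 and 11 -/

section Exceptional

variable {F : Type*} [Field F] [Finite F]

set_option maxRecDepth 100000 in
/-- The subdegree comes from a subgroup `S₄` of index 7 in `PSL(2, 7)`. -/
theorem isNontrivialSubdegree_seven (hF : Nat.card F = 7) {m : ℕ} [NeZero m] (hm : 2 ≤ m)
    (α : Points m F) : IsNontrivialSubdegree (G m F) α (7 ^ m) := by
  have := Fintype.ofFinite F
  have hcard : Fintype.card F = 7 := by rw [← Nat.card_eq_fintype_card, hF]
  have : Fact (Nat.Prime 7) := ⟨by norm_num⟩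
  have : CharP F 7 := charP_of_card_eq_prime hcard
  have hred : ∀ x ∈ quadGroup 7 (0, 6, 1, 0) (2, 3, 3, 5) (0, 5, 4, 6) (1, 1, 1, 2) 2,
      IsReducedSL 7 x := by decide +kernel
  obtain ⟨A, hA⟩ := exists_subgroup_of_quadGroup (F := F) (p := 7) (i := (0, 6, 1, 0))
    (j := (2, 3, 3, 5)) (w := (0, 5, 4, 6)) (z := (1, 1, 1, 2)) (n := 2)
    (by decide +kernel) (by decide +kernel) (by decide +kernel)
  have hlen := card_eq_length hA (by decide +kernel) hred
  have hidx : A.index = 7 := by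
    have h1 := A.card_mul_index
    rw [hlen, card_sl, hF,
      show (quadGroup 7 (0, 6, 1, 0) (2, 3, 3, 5) (0, 5, 4, 6) (1, 1, 1, 2) 2).length = 48 by
        decide +kernel] at h1
    omega
  rw [← hidx]
  -- `c` is the central involution of the setwise stabiliser of `{A, t A}`, a dihedral group of
  -- order 8
  exact isNontrivialSubdegree_index_of_list hm (p := 7) (by norm_num) hA
    (Subgroup.isCoatom_of_prime_index (by rw [hidx]; norm_num)) hred
    (by decide +kernel) (t := (0, 1, 6, 1)) (c := (1, 2, 6, 6)) (by decide +kernel)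
    (by decide +kernel) (by decide +kernel) (by decide +kernel) (by decide +kernel)
    (by decide +kernel) α

set_option maxRecDepth 100000 in
/-- The subdegree comes from a subgroup `A₅` of index 11 in `PSL(2, 11)`. -/
theorem isNontrivialSubdegree_eleven (hF : Nat.card F = 11) {m : ℕ} [NeZero m] (hm : 2 ≤ m)
    (α : Points m F) : IsNontrivialSubdegree (G m F) α (11 ^ m) := by
  have := Fintype.ofFinite F
  have hcard : Fintype.card F = 11 := by rw [← Nat.card_eq_fintype_card, hF]
  have : Fact (Nat.Prime 11) := ⟨by norm_num⟩
  have : CharP F 11 := charP_of_card_eq_prime hcard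
  have hred : ∀ x ∈ quadGroup 11 (0, 10, 1, 0) (1, 3, 3, 10) (6, 4, 3, 4) (0, 4, 8, 3) 5,
      IsReducedSL 11 x := by decide +kernel
  obtain ⟨A, hA⟩ := exists_subgroup_of_quadGroup (F := F) (p := 11) (i := (0, 10, 1, 0))
    (j := (1, 3, 3, 10)) (w := (6, 4, 3, 4)) (z := (0, 4, 8, 3)) (n := 5)
    (by decide +kernel) (by decide +kernel) (by decide +kernel)
  have hlen := card_eq_length hA (by decide +kernel) hred
  have hidx : A.index = 11 := by
    have h1 := A.card_mul_index
    rw [hlen, card_sl, hF,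
      show (quadGroup 11 (0, 10, 1, 0) (1, 3, 3, 10) (6, 4, 3, 4) (0, 4, 8, 3) 5).length = 120 by
        decide +kernel] at h1
    omega
  rw [← hidx]
  -- `c` is the central involution of the setwise stabiliser of `{A, t A}`, a dihedral group of
  -- order 12
  exact isNontrivialSubdegree_index_of_list hm (p := 11) (by norm_num) hA
    (Subgroup.isCoatom_of_prime_index (by rw [hidx]; norm_num)) hred
    (by decide +kernel) (t := (0, 1, 10, 1)) (c := (4, 1, 5, 7)) (by decide +kernel)
    (by decide +kernel) (by decide +kernel) (by decide +kernel) (by decide +kernel)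
    (by decide +kernel) α

end Exceptional

/-! ### The subgroup of index 203 -/

section TwentyNine

variable {F : Type*} [Field F]

theorem exists_natCast_eq [Finite F] {p : ℕ} [CharP F p] (hF : Nat.card F = p) (a : F) :
    ∃ n < p, (n : F) = a := by
  have := Fintype.ofFinite F
  have hp : NeZero p := ⟨by rw [← hF]; exact Nat.card_pos.ne'⟩
  obtain ⟨x, hx⟩ := (ZMod.castHom_bijective F (n := p)
    (by rw [← Nat.card_eq_fintype_card, hF])).2 a
  refine ⟨x.val, x.val_lt, ?_⟩
  rw [← hx, ZMod.castHom_apply, ZMod.natCast_val]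

/-- A nontrivial unipotent matrix in characteristic `p` has order `p`. -/
theorem orderOf_eq_of_trace_eq_two {p : ℕ} [Fact p.Prime] [CharP F p] {s : SL(2, F)}
    (hs : s 0 0 + s 1 1 = 2) (hs1 : s ≠ 1) : orderOf s = p := by
  refine orderOf_eq_prime ?_ hs1
  have hd := sl_det s
  have hsq : ((s : Matrix (Fin 2) (Fin 2) F) - 1) ^ 2 = 0 := by
    ext i j
    fin_cases i <;> fin_cases j <;>
      simp only [sq, Matrix.mul_apply, Fin.sum_univ_two, Matrix.sub_apply, Matrix.one_apply,
        Matrix.zero_apply, Fin.zero_eta, Fin.mk_one, Fin.isValue, if_true, zero_ne_one, one_ne_zero,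
        if_false]
    · linear_combination s 0 0 * hs - hd
    · linear_combination s 0 1 * hs
    · linear_combination s 1 0 * hs
    · linear_combination s 1 1 * hs - hd
  have h1 : ((s : Matrix (Fin 2) (Fin 2) F) - 1) ^ p = 0 :=
    pow_eq_zero_of_le (Fact.out : p.Prime).two_le hsq
  rw [sub_pow_char_of_commute p (Commute.one_right _), one_pow, sub_eq_zero] at h1
  apply Subtype.ext
  rw [Matrix.SpecialLinearGroup.coe_pow, h1, Matrix.SpecialLinearGroup.coe_one]

/-- A nontrivial action of a simple group on fewer than `p` points forbids elements of order `p`. -/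
theorem _root_.Subgroup.eq_top_of_index_lt_orderOf {G : Type*} [Group G] [Finite G]
    [IsSimpleGroup G] {p : ℕ} (hp : p.Prime) {g : G} (hg : orderOf g = p) {B : Subgroup G}
    (hB : B.index < p) : B = ⊤ := by
  have hk : g ∈ (MulAction.toPermHom G (G ⧸ B)).ker := by
    rw [MonoidHom.mem_ker, ← orderOf_eq_one_iff]
    have h1 : orderOf (MulAction.toPermHom G (G ⧸ B) g) ∣ p := by
      rw [← hg]
      exact orderOf_map_dvd _ _
    have h2 : orderOf (MulAction.toPermHom G (G ⧸ B) g) ∣ B.index.factorial := by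
      have := orderOf_dvd_natCard (MulAction.toPermHom G (G ⧸ B) g)
      rwa [Nat.card_perm] at this
    rcases (Nat.dvd_prime hp).1 h1 with h | h
    · exact h
    · rw [h, hp.dvd_factorial] at h2
      omega
  rcases (MonoidHom.normal_ker (MulAction.toPermHom G (G ⧸ B))).eq_bot_or_eq_top with h | h
  · rw [h, Subgroup.mem_bot] at hk
    rw [hk, orderOf_one] at hg
    exact absurd hg.symm hp.one_lt.ne'
  · rw [eq_top_iff]
    intro x _
    have hx : x ∈ (MulAction.toPermHom G (G ⧸ B)).ker := h ▸ Subgroup.mem_top x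
    have := congrArg (fun σ : Equiv.Perm (G ⧸ B) => σ ((1 : G) : G ⧸ B)) (MonoidHom.mem_ker.1 hx)
    change x • ((1 : G) : G ⧸ B) = ((1 : G) : G ⧸ B) at this
    rw [smul_mk_eq_mk_iff] at this
    simpa using this

variable [Finite F]

/-- A subgroup of `SL(2, 29)` of index 203 is maximal if it contains the centre, is transitive on
the projective line, and meets each of its other right cosets with an upper triangular
representative in a unipotent element: a larger subgroup contains an element of order 29,
so its index divides 7, and `PSL(2, 29)` has no nontrivial action on 7 points. -/
theorem isCoatom_of_index_eq (hF : Nat.card F = 29) {A : Subgroup SL(2, F)}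
    (hneg : -1 ∈ A) (hidx : A.index = 203)
    (htrans : ∀ x : F, ∃ a ∈ A, a 1 0 * x + a 1 1 = 0)
    (huni : ∀ s : SL(2, F), s 1 0 = 0 → s ∉ A → ∃ a ∈ A, (a * s) 0 0 + (a * s) 1 1 = 2) :
    IsCoatom A := by
  have := Fintype.ofFinite F
  have hcard : Fintype.card F = 29 := by rw [← Nat.card_eq_fintype_card, hF]
  have : Fact (Nat.Prime 29) := ⟨by norm_num⟩
  have : CharP F 29 := charP_of_card_eq_prime hcard
  have : IsSimpleGroup PSL(2, F) :=
    Matrix.ProjectiveSpecialLinearGroup.rank_two_simple (by rw [hF]; norm_num)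
  refine ⟨fun h => ?_, fun B hB => ?_⟩
  · rw [h, Subgroup.index_top] at hidx
    omega
  obtain ⟨s, hsB, hsA⟩ := SetLike.exists_of_lt hB
  obtain ⟨a, ha, has⟩ : ∃ a ∈ A, (a * s) 1 0 = 0 := by
    by_cases h : s 1 0 = 0
    · exact ⟨1, A.one_mem, by rw [one_mul, h]⟩
    · obtain ⟨a, ha, h1⟩ := htrans (s 0 0 / s 1 0)
      refine ⟨a, ha, ?_⟩
      rw [sl_mul_apply]
      field_simp at h1
      linear_combination h1
  obtain ⟨b, hb, hbs⟩ := huni (a * s) has fun h => hsA (by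
    have := A.mul_mem (A.inv_mem ha) h
    rwa [inv_mul_cancel_left] at this)
  rw [← mul_assoc] at hbs
  have hzB : b * a * s ∈ B := B.mul_mem (hB.le (A.mul_mem hb ha)) hsB
  have hzA : b * a * s ∉ A := fun h => hsA (by
    have := A.mul_mem (A.inv_mem (A.mul_mem hb ha)) h
    rwa [inv_mul_cancel_left] at this)
  set z := b * a * s
  have hz1 : z ≠ 1 := fun h => hzA (h ▸ A.one_mem)
  have hord : orderOf z = 29 := orderOf_eq_of_trace_eq_two hbs hz1
  have hdvd : 29 ∣ Nat.card B := by
    have := orderOf_dvd_natCard (⟨z, hzB⟩ : B)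
    rwa [Subgroup.orderOf_mk, hord] at this
  have hmul := B.card_mul_index
  rw [card_sl, hF] at hmul
  have h203 : B.index ∣ 203 := hidx ▸ Subgroup.index_dvd_of_le hB.le
  have h29 : ¬ 29 ∣ B.index := by
    intro h
    have := Nat.mul_dvd_mul hdvd h
    rw [hmul] at this
    omega
  have hlt : B.index < 29 := by
    have h7 : B.index ∣ 7 := by
      refine Nat.Coprime.dvd_of_dvd_mul_right (n := 29) ?_ (by norm_num; exact h203)
      exact ((Nat.Prime.coprime_iff_not_dvd (by norm_num)).2 h29).symm
    exact lt_of_le_of_lt (Nat.le_of_dvd (by norm_num) h7) (by norm_num)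
  have hker : (toPSL F).ker ≤ B := (ker_toPSL_le_iff.2 hneg).trans hB.le
  have hordπ : orderOf (toPSL F z) = 29 := by
    refine orderOf_eq_prime (by rw [← map_pow, ← hord, pow_orderOf_eq_one, map_one]) fun h => ?_
    rcases toPSL_eq_one_iff.1 h with h | h
    · exact hz1 h
    · exact hzA (h ▸ hneg)
  have htop := Subgroup.eq_top_of_index_lt_orderOf (by norm_num) hordπ (B := B.map (toPSL F)) (by
    rwa [← Subgroup.index_comap_of_surjective _ toPSL_surjective,
      Subgroup.comap_map_eq_self hker])
  rw [← Subgroup.comap_map_eq_self hker, htop, Subgroup.comap_top]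

set_option maxRecDepth 100000 in
/-- The subdegree comes from a maximal subgroup `A₅` of index 203 in `PSL(2, 29)`. -/
theorem isNontrivialSubdegree_twentyNine (hF : Nat.card F = 29) {m : ℕ} [NeZero m] (hm : 2 ≤ m)
    (α : Points m F) : IsNontrivialSubdegree (G m F) α (203 ^ m) := by
  have := Fintype.ofFinite F
  have hcard : Fintype.card F = 29 := by rw [← Nat.card_eq_fintype_card, hF]
  have : Fact (Nat.Prime 29) := ⟨by norm_num⟩
  have : CharP F 29 := charP_of_card_eq_prime hcard
  obtain ⟨L, hL⟩ : ∃ L,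
      L = quadGroup 29 (0, 28, 1, 0) (0, 12, 12, 0) (20, 9, 8, 8) (3, 1, 1, 20) 5 :=
    ⟨_, rfl⟩
  have hred : ∀ x ∈ L, IsReducedSL 29 x := by rw [hL]; decide +kernel
  obtain ⟨A, hA⟩ := exists_subgroup_of_quadGroup (F := F) (p := 29) (i := (0, 28, 1, 0))
    (j := (0, 12, 12, 0)) (w := (20, 9, 8, 8)) (z := (3, 1, 1, 20)) (n := 5)
    (by decide +kernel) (by decide +kernel) (by decide +kernel)
  rw [← hL] at hA
  have hidx : A.index = 203 := by
    have h1 := A.card_mul_index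
    rw [card_eq_length hA (by rw [hL]; decide +kernel) hred, card_sl, hF,
      show L.length = 120 by rw [hL]; decide +kernel] at h1
    omega
  have hneg : quadNeg 29 (1, 0, 0, 1) ∈ L := by rw [hL]; decide +kernel
  have hcoatom : IsCoatom A := by
    refine isCoatom_of_index_eq hF ((hA _).2 ⟨_, hneg, represents_one.neg (by norm_num)⟩) hidx ?_ ?_
    · intro x
      obtain ⟨n, hn, rfl⟩ := exists_natCast_eq hF x
      have key : ∀ n < 29, ∃ v ∈ L, (v.2.2.1 * n + v.2.2.2) % 29 = 0 := by
        rw [hL]; decide +kernel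
      obtain ⟨v, hv, hvn⟩ := key n hn
      obtain ⟨a, ha⟩ := (hred v hv).exists_represents (F := F)
      refine ⟨a, (hA a).2 ⟨v, hv, ha⟩, ?_⟩
      have := congrArg (fun k : ℕ => (k : F)) hvn
      simp only [natCast_mod_eq (p := 29)] at this
      push_cast at this
      rw [ha.2.2.1, ha.2.2.2, this]
    · intro s hs0 hsA
      obtain ⟨x, hx, hx0⟩ := exists_natCast_eq hF (s 0 0)
      obtain ⟨y, hy, hy0⟩ := exists_natCast_eq hF (s 0 1)
      obtain ⟨x', hx', hx1⟩ := exists_natCast_eq hF (s 1 1)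
      have hdet : x * x' % 29 = 1 := by
        have := sl_det s
        rw [hs0, mul_zero, sub_zero, ← hx0, ← hx1, ← Nat.cast_mul, ← Nat.cast_one,
          CharP.natCast_eq_natCast F 29] at this
        exact this
      have key : ∀ x ∈ List.range 29, ∀ x' ∈ List.range 29, x * x' % 29 = 1 →
          ∀ y ∈ List.range 29, (x, y, 0, x') ∈ L ∨
          ∃ v ∈ L, (v.1 * x + v.2.2.1 * y + v.2.2.2 * x') % 29 = 2 := by
        rw [hL]; decide +kernel
      rcases key x (List.mem_range.2 hx) x' (List.mem_range.2 hx') hdet y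
        (List.mem_range.2 hy) with h | ⟨v, hv, hvx⟩
      · refine absurd ((hA s).2 ⟨_, h, hx0.symm, hy0.symm, ?_, hx1.symm⟩) hsA
        rw [hs0, Nat.cast_zero]
      · obtain ⟨a, ha⟩ := (hred v hv).exists_represents (F := F)
        refine ⟨a, (hA a).2 ⟨v, hv, ha⟩, ?_⟩
        have := congrArg (fun k : ℕ => (k : F)) hvx
        simp only [natCast_mod_eq (p := 29)] at this
        push_cast at this
        rw [sl_mul_apply, sl_mul_apply, ha.1, ha.2.2.1, ha.2.2.2, hs0, ← hx0, ← hy0, ← hx1, ← this]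
        ring
  rw [← hidx]
  rw [hL] at hneg hA hred
  -- `A` and `t A t⁻¹` intersect trivially, so that the setwise stabiliser of `{A, t A}` has order at
  -- most two; it commutes with the involution `c`
  exact isNontrivialSubdegree_index_of_list hm (p := 29) (by norm_num) hA hcoatom hred
    hneg (t := (0, 1, 28, 2)) (c := (1, 28, 2, 28)) (by decide +kernel)
    (by decide +kernel) (by decide +kernel) (by decide +kernel) (by decide +kernel)
    (by decide +kernel) α

end TwentyNine

/-! ### Coprimality -/

section Arithmetic

theorem mul_pred_div_two {k : ℕ} :
    (4 * k + 3) * (4 * k + 3 - 1) / 2 = (4 * k + 3) * (2 * k + 1) := by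
  rw [show 4 * k + 3 - 1 = 2 * (2 * k + 1) by omega, Nat.mul_left_comm,
    Nat.mul_div_cancel_left _ two_pos]

theorem odd_of_three_mod_four {q : ℕ} (hq : q % 4 = 3) : Odd (q * (q - 1) / 2) := by
  obtain ⟨k, rfl⟩ : ∃ k, q = 4 * k + 3 := ⟨q / 4, by omega⟩
  rw [mul_pred_div_two]
  exact Odd.mul ⟨2 * k + 1, by ring⟩ ⟨k, rfl⟩

theorem coprime_of_three_mod_four {q : ℕ} (hq : q % 4 = 3) :
    Nat.Coprime (q * (q - 1) / 2) (q + 1) := by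
  obtain ⟨k, rfl⟩ : ∃ k, q = 4 * k + 3 := ⟨q / 4, by omega⟩
  rw [mul_pred_div_two]
  refine Nat.Coprime.mul_left (by simp) ?_
  rw [show 4 * k + 3 + 1 = 2 + (2 * k + 1) * 2 by ring, Nat.coprime_add_mul_left_right]
  exact Nat.coprime_two_right.2 ⟨k, rfl⟩

theorem coprime_of_even {q : ℕ} (hq : 4 ≤ q) (heven : Even q) :
    Nat.Coprime (q * (q - 1)) (q + 1) := by
  obtain ⟨k, rfl⟩ := heven
  refine Nat.Coprime.mul_left (by simp) ?_
  rw [show k + k + 1 = 2 + (k + k - 1) by omega, Nat.coprime_add_self_right]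
  exact Nat.coprime_two_right.2 ⟨k - 1, by omega⟩

end Arithmetic

end TwistedWreath

open TwistedWreath

theorem mainTheorem3 (m q : ℕ) [NeZero m] (hm : 2 ≤ m) (hq : 4 ≤ q)
    (F : Type*) [Field F] [Finite F] (hF : Nat.card F = q) (α : TwistedWreath.Points m F) :
    (m = 2 → q % 4 = 3 →
      ∃ d : ℕ, d ∣ 2 * (q + 1) ^ 2 ∧
        AreNontrivialCoprimeSubdegrees (TwistedWreath.G m F) α ((q * (q - 1) / 2) ^ 2) d) ∧
    (3 ≤ m → q % 4 = 3 →
      AreNontrivialCoprimeSubdegrees (TwistedWreath.G m F) α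
        ((q * (q - 1) / 2) ^ m) ((q + 1) ^ m)) ∧
    (3 ≤ m → Even q →
      AreNontrivialCoprimeSubdegrees (TwistedWreath.G m F) α
        ((q * (q - 1) / 2) ^ m) ((q + 1) ^ m) ∧
      AreNontrivialCoprimeSubdegrees (TwistedWreath.G m F) α
        ((q * (q - 1)) ^ m) ((q + 1) ^ m)) ∧
    (q = 29 → AreNontrivialCoprimeSubdegrees (TwistedWreath.G m F) α (30 ^ m) (203 ^ m)) ∧
    (q = 7 → AreNontrivialCoprimeSubdegrees (TwistedWreath.G m F) α (7 ^ m) (24 ^ m)) ∧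
    (q = 11 → AreNontrivialCoprimeSubdegrees (TwistedWreath.G m F) α (11 ^ m) (60 ^ m)) := by
  subst hF
  have two_ne_zero_of_card : ∀ p : ℕ, p.Prime → p ≠ 2 → Nat.card F = p → (2 : F) ≠ 0 := by
    intro p hp hp2 hcard h
    have := Fintype.ofFinite F
    have : Fact p.Prime := ⟨hp⟩
    have : CharP F p := charP_of_card_eq_prime (by rw [← Nat.card_eq_fintype_card, hcard])
    have h1 := (CharP.cast_eq_zero_iff F p 2).1 (by exact_mod_cast h)
    exact hp2 ((Nat.prime_dvd_prime_iff_eq hp Nat.prime_two).1 h1)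
  refine ⟨?_, ?_, ?_, ?_, ?_, ?_⟩
  · rintro rfl h3
    obtain ⟨d, hd, hsub⟩ := exists_dvd_isNontrivialSubdegree_borel (F := F) le_rfl hq α
    rw [Nat.factorial_two] at hd
    refine ⟨d, hd, isNontrivialSubdegree_involutions h3 α, hsub, ?_⟩
    refine Nat.Coprime.coprime_dvd_right hd (Nat.Coprime.mul_right ?_ ?_)
    · exact (Nat.coprime_two_right.2 (odd_of_three_mod_four h3)).pow_left 2
    · exact (coprime_of_three_mod_four h3).pow 2 2
  · intro hm3 h3
    exact ⟨isNontrivialSubdegree_involutions h3 α, isNontrivialSubdegree_borel_of_three_le hm3 hq α,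
      (coprime_of_three_mod_four h3).pow m m⟩
  · intro hm3 heven
    have := Fintype.ofFinite F
    have : CharP F 2 := by
      refine ringChar.of_eq (FiniteField.even_card_iff_char_two.2 ?_)
      rw [← Nat.card_eq_fintype_card]
      exact Nat.even_iff.1 heven
    have hcop := coprime_of_even hq heven
    exact ⟨⟨isNontrivialSubdegree_dihedral_of_charTwo hm3 hq α,
        isNontrivialSubdegree_borel_of_three_le hm3 hq α,
        (hcop.coprime_dvd_left (Nat.div_dvd_of_dvd (heven.mul_right _).two_dvd)).pow m m⟩,
      isNontrivialSubdegree_torus_of_charTwo α, isNontrivialSubdegree_borel_of_three_le hm3 hq α,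
      hcop.pow m m⟩
  · intro h
    have : Fact (Nat.Prime 29) := ⟨by norm_num⟩
    have := Fintype.ofFinite F
    have : CharP F 29 := charP_of_card_eq_prime (by rw [← Nat.card_eq_fintype_card, h])
    -- `12 ^ 2 + 1 = 5 * 29`
    have h12 : (12 : F) ^ 2 = -1 := by
      have : ((145 : ℕ) : F) = 0 := (CharP.cast_eq_zero_iff F 29 145).2 (by norm_num)
      push_cast at this
      linear_combination this
    have h30 := isNontrivialSubdegree_borel_of_sq_eq_neg_one hm
      (two_ne_zero_of_card 29 (by norm_num) (by norm_num) h) h12 α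
    rw [h] at h30
    exact ⟨h30, isNontrivialSubdegree_twentyNine h hm α, Nat.Coprime.pow _ _ (by norm_num)⟩
  · intro h
    have h24 := isNontrivialSubdegree_unipotent
      (two_ne_zero_of_card 7 (by norm_num) (by norm_num) h) α
    rw [h] at h24
    exact ⟨isNontrivialSubdegree_seven h hm α, h24, Nat.Coprime.pow _ _ (by norm_num)⟩
  · intro h
    have h60 := isNontrivialSubdegree_unipotent
      (two_ne_zero_of_card 11 (by norm_num) (by norm_num) h) α
    rw [h] at h60
    exact ⟨isNontrivialSubdegree_eleven h hm α, h60, Nat.Coprime.pow _ _ (by norm_num)⟩
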